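/- Let $(R,\mathfrak m)$ be a commutative Noetherian local ring and let $d\ge 0$ be an integer. A $\mathbb Z/d$-graded differential module is an $R$-module $D=\bigoplus_{j\in\mathbb Z/d}D_j$ with an endomorphism $\partial$ such that $\partial^2=0$ and $\partial(D_j)\subseteq D_{j-1}$; its homology is $H_j(D)=\ker(D_j\to D_{j-1})/\operatorname{im}(D_{j+1}\to D_j)$. (For $d=1$ this is an ungraded differential module, for $d=0$ a chain complex.) Morphisms have degree $0$ and commute with $\partial$; $\phi,\psi$ are homotopic if $\phi-\psi=\partial h+h\partial$ for an $R$-linear $h$ of degree $1$; a quasi-isomorphism is a morphism inducing isomorphisms on homology. A flag is such a module $F$ with exhaustive filtrations $0=F^{-1}_j\subseteq F^0_j\subseteq F^1_j\subseteq\cdots$ of the $F_j$ such that $\partial(F^i_j)\subseteq F^{i-1}_{j-1}$; it is projective if all the modules $F^i_j/F^{i-1}_j$ are projective. A morphism of flags is flag-preserving if it maps $F^i_j$ into $F'^{\,i}_j$, and a homotopy $h$ is flag-preserving if $h(F^i_j)\subseteq F'^{\,i+1}_{j+1}$. The anchor of $F$ is the family, indexed by $j\in\mathbb Z/d$, of complexes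 $F_{\bullet,j}$ with $F_{i,j}=F^i_{i+j}/F^{i-1}_{i+j}$ for $i\ge 0$ and the differential induced by $\partial$. An anchored resolution of $D$ is a projective flag $F$ together with a quasi-isomorphism $F\to D$ (the augmentation, not assumed to respect any filtration) such that, for each $j$, $F_{\bullet,j}$ is a projective resolution of $H_j(D)$. It is quasiminimal if each $F_{\bullet,j}$ is a minimal free resolution of $H_j(D)$, that is, a free resolution whose differentials have image in $\mathfrak m F_{\bullet,j}$. **Theorem.** Let $D$ be a $\mathbb Z/d$-graded differential module such that every $H_j(D)$ is finitely generated over $R$. Then: 1. $D$ has a quasiminimal anchored resolution. 2. Any two quasiminimal resolutions of $D$ are isomorphic by a flag-preserving isomorphism (with flag-preserving inverse). 3. Any two anchored resolutions of $D$ are homotopy equivalent by flag-preserving morphisms and flag-preserving homotopies. 4. Every anchored resolution $F$ of $D$ contains every quasiminimal resolution $Q$ of $D$ as a flag-preserving direct summand: there are flag-preserving morphisms $i\colon Q\to F$ and $p\colon F\to Q$ with $p\,i=\mathrm{id}_Q$. Moreover, the morphisms between resolutions in 2, 3 and 4 (in both directions) can be chosen to commute up to homotopy with the augmentations to $D$.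 -/

import Mathlib

universe u v w w'

/-- A `ℤ/d`-graded differential `R`-module: an `R`-module with a direct sum decomposition indexed
by `ℤ/d` and a square-zero endomorphism of degree `-1`. For `d = 1` the grading carries no
information, and for `d = 0` (where `ZMod 0 = ℤ`) this is a chain complex. -/
structure DiffMod (R : Type u) [CommRing R] (d : ℕ) where
  carrier : Type v
  [addCommGroup : AddCommGroup carrier]
  [module : Module R carrier]
  /-- the homogeneous components `D_j` -/
  deg : ZMod d → Submodule R carrier
  isInternal : DirectSum.IsInternal deg
  /-- the differential -/
  diff : carrier →ₗ[R] carrier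
  diff_diff : ∀ x, diff (diff x) = 0
  diff_mem_deg : ∀ j, ∀ x ∈ deg j, diff x ∈ deg (j - 1)

attribute [instance] DiffMod.addCommGroup DiffMod.module

namespace DiffMod

variable {R : Type u} [CommRing R] {d : ℕ}

/-- The cycles `Z_j(D) = ker (D_j → D_{j-1})`. -/
def cycles (D : DiffMod.{u, v} R d) (j : ZMod d) : Submodule R D.carrier :=
  LinearMap.ker D.diff ⊓ D.deg j

/-- The boundaries `B_j(D) = im (D_{j+1} → D_j)`. -/
def boundaries (D : DiffMod.{u, v} R d) (j : ZMod d) : Submodule R D.carrier :=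
  (D.deg (j + 1)).map D.diff

/-- The homology `H_j(D) = Z_j(D) / B_j(D)`. -/
abbrev homology (D : DiffMod.{u, v} R d) (j : ZMod d) : Type v :=
  ↥(D.cycles j) ⧸ (D.boundaries j).submoduleOf (D.cycles j)

/-- Morphisms of `ℤ/d`-graded differential modules. -/
structure Hom (D : DiffMod.{u, v} R d) (E : DiffMod.{u, w} R d) where
  toLin : D.carrier →ₗ[R] E.carrier
  comm : ∀ x, E.diff (toLin x) = toLin (D.diff x)
  mem_deg : ∀ j, ∀ x ∈ D.deg j, toLin x ∈ E.deg j

namespace Hom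

variable {D : DiffMod.{u, v} R d} {E : DiffMod.{u, w} R d} {G : DiffMod.{u, w'} R d}

/-- Composition of morphisms. -/
def comp (g : Hom E G) (f : Hom D E) : Hom D G where
  toLin := g.toLin ∘ₗ f.toLin
  comm x := by simp [g.comm, f.comm]
  mem_deg j x hx := g.mem_deg j _ (f.mem_deg j x hx)

theorem map_cycles (f : Hom D E) (j : ZMod d) :
    ∀ x ∈ D.cycles j, f.toLin x ∈ E.cycles j := by
  rintro x ⟨hx, hj⟩
  refine ⟨?_, f.mem_deg j x hj⟩
  have hx' : D.diff x = 0 := hx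
  change E.diff (f.toLin x) = 0
  rw [f.comm, hx', map_zero]

theorem map_boundaries (f : Hom D E) (j : ZMod d) :
    ∀ x ∈ D.boundaries j, f.toLin x ∈ E.boundaries j := by
  rintro x ⟨y, hy, rfl⟩
  exact ⟨f.toLin y, f.mem_deg _ y hy, f.comm y⟩

/-- The map `H_j(D) → H_j(E)` induced by a morphism `D → E`. -/
def homologyMap (f : Hom D E) (j : ZMod d) : D.homology j →ₗ[R] E.homology j :=
  Submodule.mapQ _ _ (f.toLin.restrict (f.map_cycles j))
    (fun x hx => f.map_boundaries j x hx)

/-- A quasi-isomorphism is a morphism inducing isomorphisms on homology. -/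
def IsQuasiIso (f : Hom D E) : Prop :=
  ∀ j, Function.Bijective (f.homologyMap j)

/-- Two morphisms are homotopic if their difference is `d h + h d` for some `R`-linear map `h`
of `ℤ/d`-degree `1`. -/
def Homotopic (f g : Hom D E) : Prop :=
  ∃ h : D.carrier →ₗ[R] E.carrier,
    (∀ j, ∀ x ∈ D.deg j, h x ∈ E.deg (j + 1)) ∧
    ∀ x, f.toLin x - g.toLin x = E.diff (h x) + h (D.diff x)

end Hom

end DiffMod

/-- A `ℤ/d`-graded flag: a differential module with an exhaustive graded filtration
`0 = D^{-1}_j ⊆ D^0_j ⊆ D^1_j ⊆ ⋯` (here `fil i j` is `D^i_j` for `i ≥ 0`) such that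
`d (D^i_j) ⊆ D^{i-1}_{j-1}` for all `i ≥ 0`. -/
structure DiffFlag (R : Type u) [CommRing R] (d : ℕ) extends DiffMod.{u, v} R d where
  fil : ℕ → ZMod d → Submodule R carrier
  fil_le_deg : ∀ i j, fil i j ≤ deg j
  fil_mono : ∀ i j, fil i j ≤ fil (i + 1) j
  fil_exhaustive : ∀ j, ∀ x ∈ deg j, ∃ i, x ∈ fil i j
  diff_fil_zero : ∀ j, ∀ x ∈ fil 0 j, diff x = 0
  diff_fil_succ : ∀ i j, ∀ x ∈ fil (i + 1) j, diff x ∈ fil i (j - 1)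

namespace DiffFlag

variable {R : Type u} [CommRing R] {d : ℕ}

/-- The previous filtration step: `filBelow i j` is `D^{i-1}_j`, with `D^{-1}_j = 0`. -/
def filBelow (F : DiffFlag.{u, v} R d) : ℕ → ZMod d → Submodule R F.carrier
  | 0, _ => ⊥
  | i + 1, j => F.fil i j

/-- The associated graded piece `D^i_j / D^{i-1}_j`. -/
abbrev gr (F : DiffFlag.{u, v} R d) (i : ℕ) (j : ZMod d) : Type v :=
  ↥(F.fil i j) ⧸ (F.filBelow i j).submoduleOf (F.fil i j)

/-- A projective flag: all associated graded pieces are projective. Hence the filtration splits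
and the underlying module is the direct sum of these pieces. -/
def IsProjective (F : DiffFlag.{u, v} R d) : Prop :=
  ∀ i j, Module.Projective R (F.gr i j)

/-- The module `D_{i,j}` in homological degree `i` of the `j`-th strand of the anchor; its
`ℤ/d`-degree is `i + j`. -/
abbrev anchor (F : DiffFlag.{u, v} R d) (j : ZMod d) (i : ℕ) : Type v :=
  F.gr i ((i : ZMod d) + j)

theorem diff_mem_anchor (F : DiffFlag.{u, v} R d) (j : ZMod d) (i : ℕ) :
    ∀ x ∈ F.fil (i + 1) (((i + 1 : ℕ) : ZMod d) + j), F.diff x ∈ F.fil i ((i : ZMod d) + j) := by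
  intro x hx
  have h := F.diff_fil_succ i _ x hx
  have e : ((i + 1 : ℕ) : ZMod d) + j - 1 = (i : ZMod d) + j := by push_cast; ring
  rwa [e] at h

theorem diff_mem_filBelow (F : DiffFlag.{u, v} R d) (j : ZMod d) (i : ℕ) :
    ∀ x ∈ F.filBelow (i + 1) (((i + 1 : ℕ) : ZMod d) + j),
      F.diff x ∈ F.filBelow i ((i : ZMod d) + j) := by
  intro x hx
  have hx' : x ∈ F.fil i (((i + 1 : ℕ) : ZMod d) + j) := hx
  cases i with
  | zero => exact (Submodule.mem_bot R).2 (F.diff_fil_zero _ x hx')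
  | succ k =>
    have h := F.diff_fil_succ k _ x hx'
    have e : ((k + 1 + 1 : ℕ) : ZMod d) + j - 1 = ((k + 1 : ℕ) : ZMod d) + j := by
      push_cast; ring
    rw [e] at h
    exact h

/-- The differential `D_{i+1,j} → D_{i,j}` of the anchor: the map induced by `d` on associated
graded pieces, which is the component of `d` that lowers the filtration degree by exactly one. -/
def anchorDiff (F : DiffFlag.{u, v} R d) (j : ZMod d) (i : ℕ) :
    F.anchor j (i + 1) →ₗ[R] F.anchor j i :=
  Submodule.mapQ _ _ (F.diff.restrict (F.diff_mem_anchor j i))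
    (fun x hx => F.diff_mem_filBelow j i x hx)

/-- DiffFlag-preserving morphisms. -/
structure Hom (F : DiffFlag.{u, v} R d) (G : DiffFlag.{u, w} R d) extends
    DiffMod.Hom F.toDiffMod G.toDiffMod where
  mem_fil : ∀ i j, ∀ x ∈ F.fil i j, toLin x ∈ G.fil i j

namespace Hom

variable {F : DiffFlag.{u, v} R d} {G : DiffFlag.{u, w} R d} {K : DiffFlag.{u, w'} R d}

/-- The identity morphism. -/
def id (F : DiffFlag.{u, v} R d) : Hom F F where
  toLin := LinearMap.id
  comm _ := rfl
  mem_deg _ _ hx := hx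
  mem_fil _ _ _ hx := hx

/-- Composition of flag-preserving morphisms. -/
def comp (g : Hom G K) (f : Hom F G) : Hom F K where
  toHom := g.toHom.comp f.toHom
  mem_fil i j x hx := g.mem_fil i j _ (f.mem_fil i j x hx)

/-- Two flag-preserving morphisms are homotopic in a flag-preserving way if their difference is
`d h + h d` for some `R`-linear map `h` of `ℤ/d`-degree `1` that raises the filtration degree by
at most one. -/
def Homotopic (f g : Hom F G) : Prop :=
  ∃ h : F.carrier →ₗ[R] G.carrier,
    (∀ i j, ∀ x ∈ F.fil i j, h x ∈ G.fil (i + 1) (j + 1)) ∧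
    ∀ x, f.toLin x - g.toLin x = G.diff (h x) + h (F.diff x)

end Hom

end DiffFlag

section Resolutions

variable {R : Type u} [CommRing R]

/-- The complex `⋯ → C 2 → C 1 → C 0` with differentials `δ` and augmentation `ε : C 0 → M` is a
projective resolution of `M`. -/
structure IsProjectiveResolution (C : ℕ → Type v) [∀ n, AddCommGroup (C n)] [∀ n, Module R (C n)]
    (δ : ∀ n, C (n + 1) →ₗ[R] C n) {M : Type w} [AddCommGroup M] [Module R M]
    (ε : C 0 →ₗ[R] M) : Prop where
  projective : ∀ n, Module.Projective R (C n)
  exact_succ : ∀ n, Function.Exact (δ (n + 1)) (δ n)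
  exact_zero : Function.Exact (δ 0) ε
  surjective : Function.Surjective ε

/-- A minimal free resolution over a local ring with maximal ideal `𝔪`: a resolution by free
modules with `δ (C (n + 1)) ⊆ 𝔪 (C n)` for all `n`. -/
structure IsMinimalFreeResolution [IsLocalRing R] (C : ℕ → Type v) [∀ n, AddCommGroup (C n)]
    [∀ n, Module R (C n)] (δ : ∀ n, C (n + 1) →ₗ[R] C n) {M : Type w} [AddCommGroup M]
    [Module R M] (ε : C 0 →ₗ[R] M) : Prop extends IsProjectiveResolution C δ ε where
  free : ∀ n, Module.Free R (C n)
  minimal : ∀ n, LinearMap.range (δ n) ≤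
    IsLocalRing.maximalIdeal R • (⊤ : Submodule R (C n))

variable {d : ℕ}

/-- A projective flag resolution of a differential module `D`: a projective flag with a
quasi-isomorphism to `D` (which need not respect any filtration). -/
structure FlagResolution (D : DiffMod.{u, v} R d) where
  flag : DiffFlag.{u, w} R d
  isProjective : flag.IsProjective
  /-- the augmentation -/
  aug : DiffMod.Hom flag.toDiffMod D
  isQuasiIso : aug.IsQuasiIso

/-- A projective flag resolution of `D` is anchored if its anchor is a projective resolution of
the homology of `D`: the `j`-th strand of the anchor resolves `H_j(D)`. -/
def FlagResolution.IsAnchored {D : DiffMod.{u, v} R d} (F : FlagResolution.{u, v, w} D) : Prop :=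
  ∀ j, ∃ ε : F.flag.anchor j 0 →ₗ[R] D.homology j,
    IsProjectiveResolution (F.flag.anchor j) (F.flag.anchorDiff j) ε

/-- A resolution is quasiminimal if its anchor is a minimal free resolution of the homology
of `D`; in particular it is then anchored. -/
def FlagResolution.IsQuasiminimal [IsLocalRing R] {D : DiffMod.{u, v} R d}
    (F : FlagResolution.{u, v, w} D) : Prop :=
  ∀ j, ∃ ε : F.flag.anchor j 0 →ₗ[R] D.homology j,
    IsMinimalFreeResolution (F.flag.anchor j) (F.flag.anchorDiff j) ε

theorem FlagResolution.IsQuasiminimal.isAnchored [IsLocalRing R] {D : DiffMod.{u, v} R d}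
    {F : FlagResolution.{u, v, w} D} (h : F.IsQuasiminimal) : F.IsAnchored :=
  fun j => (h j).imp fun _ hε => hε.toIsProjectiveResolution

/-- A morphism of flag resolutions respects the augmentations if it commutes with them up to
homotopy of morphisms of differential modules. -/
def FlagResolution.RespectsAug {D : DiffMod.{u, v} R d} {F : FlagResolution.{u, v, w} D}
    {G : FlagResolution.{u, v, w'} D} (f : DiffFlag.Hom F.flag G.flag) : Prop :=
  DiffMod.Hom.Homotopic (G.aug.comp f.toHom) F.aug

end Resolutions

-- The cone of an augmentation `a : F → D` is filtered by `F`, with `D` in filtration `-1`. A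
-- projective flag with augmentation is an anchored resolution exactly when this cone is acyclic
-- with control of the filtration: a cycle of filtration `i - 1` is the boundary of an element of
-- filtration `i` (`ConeAcyclic`). One direction is `AnchorExact.coneAcyclic`, the other
-- `ConeAcyclic.isQuasiIso` together with `ConeAcyclic.isProjectiveResolution`.
--
-- Maps out of a projective flag are built one filtration step at a time
-- (`IsProjective.exists_solution`). If the target is such a cone, every obstruction is a cycle and
-- can be killed in the required filtration. This yields comparison morphisms
-- (`IsProjective.exists_hom`) and homotopies between them (`IsProjective.homotopic`), hence the
-- homotopy equivalence of anchored resolutions.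
--
-- If the anchor is minimal, `∂h + h∂` vanishes on the graded pieces modulo the maximal ideal. An
-- endomorphism homotopic to the identity is then the identity there, and Nakayama's lemma on the
-- finitely generated steps `F^i_j` makes it an automorphism (`IsMinimal.exists_inverse`).
-- Uniqueness and the splitting follow by correcting a comparison morphism with such an automorphism
-- (`IsQuasiminimal.exists_retraction`).
--
-- For existence, minimal free resolutions of all the `H_t(D)` are fixed, and their generators are
-- attached in order of homological degree. The homology of the cone after `n` steps is the `n`-th
-- syzygy module of the `H_t(D)`, and the generators of degree `n` are attached to kill it
-- (`IsStage.succ`, `exists_coneDiff`).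

universe w''

/-! ### Filtrations and the splitting of projective flags -/

namespace DiffFlag

variable {R : Type u} [CommRing R] {d : ℕ}

theorem filBelow_le_fil (F : DiffFlag.{u, v} R d) (i : ℕ) (j : ZMod d) :
    F.filBelow i j ≤ F.fil i j := by
  cases i with
  | zero => exact bot_le
  | succ i => exact F.fil_mono i j

theorem fil_le_of_le (F : DiffFlag.{u, v} R d) (j : ZMod d) {i k : ℕ} (h : i ≤ k) :
    F.fil i j ≤ F.fil k j :=
  monotone_nat_of_le_succ (f := fun i => F.fil i j) (fun i => F.fil_mono i j) h

theorem fil_le_filBelow (F : DiffFlag.{u, v} R d) (j : ZMod d) {i k : ℕ} (h : i < k) :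
    F.fil i j ≤ F.filBelow k j := by
  cases k with
  | zero => omega
  | succ k => exact F.fil_le_of_le j (Nat.lt_succ_iff.1 h)

theorem diff_mem_filBelow_sub_one (F : DiffFlag.{u, v} R d) {i : ℕ} {j : ZMod d} {x : F.carrier}
    (hx : x ∈ F.fil i j) : F.diff x ∈ F.filBelow i (j - 1) := by
  cases i with
  | zero => exact (Submodule.mem_bot R).2 (F.diff_fil_zero j x hx)
  | succ i => exact F.diff_fil_succ i j x hx

/-- Linear maps which agree on all the filtration steps are equal. -/
theorem eqOn_fil_ext (F : DiffFlag.{u, v} R d) {C : Type w} [AddCommGroup C] [Module R C]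
    {f g : F.carrier →ₗ[R] C} (h : ∀ i j, ∀ x ∈ F.fil i j, f x = g x) (x : F.carrier) :
    f x = g x := by
  have ht : (⊤ : Submodule R F.carrier) ≤ LinearMap.eqLocus f g := by
    rw [← F.isInternal.submodule_iSup_eq_top]
    refine iSup_le fun j y hy => ?_
    obtain ⟨i, hi⟩ := F.fil_exhaustive j y hy
    exact h i j y hi
  exact ht (Submodule.mem_top (x := x))

/-- In a relation of fixed degree, the nonzero term of highest filtration is minus a sum of terms of
lower filtration, so its class in the graded piece vanishes. A section recovers `g p` from that
class. -/
theorem sections_sum_eq_zero (F : DiffFlag.{u, v} R d)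
    (s : ∀ i j, F.gr i j →ₗ[R] F.fil i j)
    (hs : ∀ i j g, ((F.filBelow i j).submoduleOf (F.fil i j)).mkQ (s i j g) = g)
    (S : Finset (ℕ × ZMod d)) (g : ∀ p : ℕ × ZMod d, F.gr p.1 p.2)
    (h0 : ∑ p ∈ S, (s p.1 p.2 (g p) : F.carrier) = 0) : ∀ p ∈ S, g p = 0 := by
  classical
  have hdeg : ∀ j, ∑ p ∈ S with p.2 = j, (s p.1 p.2 (g p) : F.carrier) = 0 := by
    intro j
    have hind := (iSupIndep_iff_finsetSum_eq_zero_imp_eq_zero F.deg).1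
      F.isInternal.submodule_iSupIndep (S.image Prod.snd)
      (fun j => ∑ p ∈ S with p.2 = j, (s p.1 p.2 (g p) : F.carrier))
    by_cases hj : j ∈ S.image Prod.snd
    · refine hind ?_ ?_ j hj
      · intro j _
        refine Submodule.sum_mem _ fun p hp => ?_
        obtain rfl := (Finset.mem_filter.1 hp).2
        exact F.fil_le_deg _ _ (s p.1 p.2 (g p)).2
      · rw [Finset.sum_fiberwise_of_maps_to (fun p hp => Finset.mem_image_of_mem _ hp), h0]
    · refine Finset.sum_eq_zero fun p hp => ?_
      obtain ⟨hp', rfl⟩ := Finset.mem_filter.1 hp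
      exact absurd (Finset.mem_image_of_mem Prod.snd hp') hj
  by_contra! hne
  obtain ⟨q, hqS, hq⟩ := hne
  obtain ⟨p, hp, hmax⟩ := Finset.exists_max_image
    (S.filter fun p => p.2 = q.2 ∧ g p ≠ 0) Prod.fst ⟨q, by simp [hqS, hq]⟩
  obtain ⟨hpS, hpq, hgp⟩ : p ∈ S ∧ p.2 = q.2 ∧ g p ≠ 0 := by simpa using hp
  apply hgp
  rw [← hs p.1 p.2 (g p), Submodule.mkQ_apply, Submodule.Quotient.mk_eq_zero]
  change (s p.1 p.2 (g p) : F.carrier) ∈ F.filBelow p.1 p.2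
  have hsum := hdeg p.2
  rw [← Finset.add_sum_erase _ _ (show p ∈ S.filter (fun r => r.2 = p.2) by simp [hpS])] at hsum
  rw [eq_neg_of_add_eq_zero_left hsum]
  refine Submodule.neg_mem _ (Submodule.sum_mem _ fun r hr => ?_)
  obtain ⟨hrp, hrS, hr2⟩ : r ≠ p ∧ r ∈ S ∧ r.2 = p.2 := by simpa using hr
  by_cases hr0 : g r = 0
  · rw [hr0, map_zero]; exact Submodule.zero_mem _
  · have hle := hmax r (by simp [hrS, hr2, hpq, hr0])
    have hlt : r.1 < p.1 := lt_of_le_of_ne hle fun h => hrp (Prod.ext h hr2)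
    rw [← hr2]
    exact F.fil_le_filBelow _ hlt (s r.1 r.2 (g r)).2

/-- A projective flag splits: the associated graded pieces embed in the flag with direct sum
everything. -/
theorem IsProjective.exists_sections {F : DiffFlag.{u, v} R d} (hF : F.IsProjective) :
    ∃ s : ∀ i j, F.gr i j →ₗ[R] F.carrier,
      (∀ i j g, s i j g ∈ F.fil i j) ∧
      (∀ i j, ∀ x ∈ F.fil i j, ∃ g, x - s i j g ∈ F.filBelow i j) ∧
      Function.Bijective
        (DirectSum.toModule R (ℕ × ZMod d) F.carrier (fun p => s p.1 p.2)) := by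
  classical
  have hsec : ∀ i j, ∃ s : F.gr i j →ₗ[R] F.fil i j,
      ((F.filBelow i j).submoduleOf (F.fil i j)).mkQ ∘ₗ s = LinearMap.id := fun i j =>
    have := hF i j
    Module.projective_lifting_property _ _ (Submodule.mkQ_surjective _)
  choose s hs using hsec
  have hs' : ∀ i j g, ((F.filBelow i j).submoduleOf (F.fil i j)).mkQ (s i j g) = g :=
    fun i j g => LinearMap.congr_fun (hs i j) g
  have hdec : ∀ i j, ∀ x ∈ F.fil i j, ∃ g, x - (s i j g : F.carrier) ∈ F.filBelow i j := by
    intro i j x hx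
    refine ⟨Submodule.mkQ _ ⟨x, hx⟩, ?_⟩
    have h := hs' i j (Submodule.mkQ _ ⟨x, hx⟩)
    exact (Submodule.Quotient.eq ((F.filBelow i j).submoduleOf (F.fil i j))).1 h.symm
  refine ⟨fun i j => (F.fil i j).subtype ∘ₗ s i j, fun i j g => (s i j g).2, hdec, ?_, ?_⟩
  · rw [injective_iff_map_eq_zero]
    intro x hx
    have hx' : ∑ p ∈ x.support, (s p.1 p.2 (x p) : F.carrier) = 0 := by
      rw [← hx]
      conv_rhs => rw [← DirectSum.sum_support_of x, map_sum]
      refine Finset.sum_congr rfl fun p _ => ?_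
      exact (DirectSum.toModule_lof (M := fun p : ℕ × ZMod d => F.gr p.1 p.2)
        (φ := fun p => (F.fil p.1 p.2).subtype ∘ₗ s p.1 p.2) R p (x p)).symm
    ext p : 1
    by_cases hp : p ∈ x.support
    · exact F.sections_sum_eq_zero s hs' _ _ hx' p hp
    · simpa using hp
  · rw [← LinearMap.range_eq_top, eq_top_iff, ← F.isInternal.submodule_iSup_eq_top]
    refine iSup_le fun j x hx => ?_
    obtain ⟨i, hi⟩ := F.fil_exhaustive j x hx
    clear hx
    induction i using Nat.strong_induction_on generalizing x with
    | _ i ih =>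
      obtain ⟨g, hg⟩ := hdec i j x hi
      rw [← sub_add_cancel x (s i j g : F.carrier)]
      refine Submodule.add_mem _ ?_ ⟨DirectSum.lof R _ (fun p : ℕ × ZMod d => F.gr p.1 p.2) (i, j) g,
        DirectSum.toModule_lof (M := fun p : ℕ × ZMod d => F.gr p.1 p.2) R (i, j) g⟩
      cases i with
      | zero => rw [(Submodule.mem_bot R).1 hg]; exact Submodule.zero_mem _
      | succ i => exact ih i (Nat.lt_succ_self i) _ hg

end DiffFlag

/-! ### Maps out of a projective flag by obstruction theory -/

theorem Module.Projective.exists_lift_mem {R : Type u} [CommRing R] {P : Type v} [AddCommGroup P]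
    [Module R P] [Module.Projective R P] {C : Type w} [AddCommGroup C] [Module R C]
    (f : C →ₗ[R] C) (ψ : P →ₗ[R] C) (S : Submodule R C) (h : ∀ x, ∃ b ∈ S, f b = ψ x) :
    ∃ φ : P →ₗ[R] C, ∀ x, φ x ∈ S ∧ f (φ x) = ψ x := by
  obtain ⟨φ, hφ⟩ := Module.projective_lifting_property
    ((f.comp S.subtype).rangeRestrict)
    (ψ.codRestrict (LinearMap.range (f.comp S.subtype)) fun x => by
      obtain ⟨b, hb, hbx⟩ := h x
      exact ⟨⟨b, hb⟩, hbx⟩) (LinearMap.surjective_rangeRestrict _)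
  refine ⟨S.subtype ∘ₗ φ, fun x => ⟨(φ x).2, ?_⟩⟩
  exact congrArg Subtype.val (LinearMap.congr_fun hφ x)

namespace DiffFlag

variable {R : Type u} [CommRing R] {d : ℕ}

/-- Maps out of a projective flag which solve `∂ H = H δ + ω` exist as soon as the relevant
obstructions vanish. -/
theorem IsProjective.exists_solution {F : DiffFlag.{u, v} R d} (hF : F.IsProjective)
    {C : Type w} [AddCommGroup C] [Module R C] (f : C →ₗ[R] C)
    (δ : F.carrier →ₗ[R] F.carrier) (hδδ : ∀ x, δ (δ x) = 0)
    (hδ : ∀ i j, ∀ x ∈ F.fil i j, δ x ∈ F.filBelow i (j - 1))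
    (A B : ℕ → ZMod d → Submodule R C)
    (hAB : ∀ i j, ∀ c ∈ A i j, f c = 0 → ∃ b ∈ B i j, f b = c)
    (hBA : ∀ i j, B i (j - 1) ≤ A (i + 1) j) (hB : ∀ i j, B i j ≤ B (i + 1) j)
    (ω : F.carrier →ₗ[R] C) (hωA : ∀ i j, ∀ x ∈ F.fil i j, ω x ∈ A i j)
    (hω : ∀ x, f (ω x) = - ω (δ x)) :
    ∃ H : F.carrier →ₗ[R] C, (∀ i j, ∀ x ∈ F.fil i j, H x ∈ B i j) ∧
      ∀ x, f (H x) = H (δ x) + ω x := by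
  classical
  obtain ⟨s, hsmem, hsdec, hsbij⟩ := hF.exists_sections
  -- The splitting allows a map out of `F` to be prescribed freely on the sections.
  have hext : ∀ φ : ∀ i j, F.gr i j →ₗ[R] C, ∃ H : F.carrier →ₗ[R] C,
      ∀ i j g, H (s i j g) = φ i j g := by
    intro φ
    refine ⟨DirectSum.toModule R (ℕ × ZMod d) C (fun p => φ p.1 p.2) ∘ₗ
      (LinearEquiv.ofBijective _ hsbij).symm.toLinearMap, fun i j g => ?_⟩
    have : (LinearEquiv.ofBijective _ hsbij).symm (s i j g) =
        DirectSum.lof R _ (fun p : ℕ × ZMod d => F.gr p.1 p.2) (i, j) g := by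
      rw [LinearEquiv.symm_apply_eq]
      exact (DirectSum.toModule_lof (M := fun p : ℕ × ZMod d => F.gr p.1 p.2)
        (φ := fun p => s p.1 p.2) R (i, j) g).symm
    simp only [LinearMap.comp_apply, LinearEquiv.coe_coe, this]
    rw [DirectSum.toModule_lof]
  choose ext hext using hext
  -- a map is determined on a step of the filtration by its values on the sections
  have heq : ∀ (n : ℕ) (H H' : F.carrier →ₗ[R] C),
      (∀ i ≤ n, ∀ j g, H (s i j g) = H' (s i j g)) → ∀ j, ∀ x ∈ F.fil n j, H x = H' x := by
    intro n H H' h j x hx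
    induction n generalizing x with
    | zero =>
      obtain ⟨g, hg⟩ := hsdec 0 j x hx
      rw [sub_eq_zero.1 ((Submodule.mem_bot R).1 hg), h 0 le_rfl]
    | succ n ih =>
      obtain ⟨g, hg⟩ := hsdec _ j x hx
      have := ih (fun i hi => h i (hi.trans n.le_succ)) _ hg
      rw [map_sub, map_sub, h _ le_rfl] at this
      exact sub_left_inj.1 this
  let good (H : F.carrier →ₗ[R] C) (i : ℕ) (j : ZMod d) : Prop :=
    ∀ x ∈ F.fil i j, H x ∈ B i j ∧ f (H x) = H (δ x) + ω x
  -- If `H` is correct below filtration `i`, then `H δ + ω` is killed by `f` on the next piece,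
  -- since `δ² = 0` and `f ω = -ω δ`. So `hAB` solves the equation pointwise and projectivity makes
  -- the solution linear. The default value `0` makes the choice total, so that the recursion
  -- carries no proofs.
  have hlift : ∀ (H : F.carrier →ₗ[R] C) (i : ℕ) (j : ZMod d), ∃ φ : F.gr i j →ₗ[R] C,
      (∀ k < i, good H k (j - 1)) →
        ∀ g, φ g ∈ B i j ∧ f (φ g) = H (δ (s i j g)) + ω (s i j g) := by
    intro H i j
    by_cases hg : ∀ k < i, good H k (j - 1)
    · have := hF i j
      obtain ⟨φ, hφ⟩ := Module.Projective.exists_lift_mem f ((H ∘ₗ δ + ω) ∘ₗ s i j) (B i j) (by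
        intro g
        have hx := hsmem i j g
        have hδx := hδ i j _ hx
        refine hAB i j _ (Submodule.add_mem _ ?_ (hωA i j _ hx)) ?_
        · cases i with
          | zero =>
            have : δ (s 0 j g) = 0 := (Submodule.mem_bot R).1 hδx
            simp [this]
          | succ i => exact hBA i j (hg i (Nat.lt_succ_self i) _ hδx).1
        · have : f (H (δ (s i j g))) = ω (δ (s i j g)) := by
            cases i with
            | zero =>
              have : δ (s 0 j g) = 0 := (Submodule.mem_bot R).1 hδx
              simp [this]
            | succ i =>
              rw [(hg i (Nat.lt_succ_self i) _ hδx).2, hδδ, map_zero, zero_add]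
          simp [this, hω])
      exact ⟨φ, fun _ => hφ⟩
    · exact ⟨0, fun h => absurd h hg⟩
  choose T hT using hlift
  -- `Hs n` is correct in filtration `< n`. Passing to `Hs (n + 1)` keeps those values and corrects
  -- filtration `n`; what happens above is irrelevant.
  let Hs : ℕ → (F.carrier →ₗ[R] C) := fun n => Nat.rec 0
    (fun n H => ext fun i j => if i < n then H ∘ₗ s i j else T H i j) n
  have hHs : ∀ n i j g, Hs (n + 1) (s i j g) =
      if i < n then Hs n (s i j g) else T (Hs n) i j g := by
    intro n i j g
    change ext _ (s i j g) = _
    rw [hext]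
    split_ifs <;> rfl
  have hstab : ∀ n, ∀ i < n, ∀ j, ∀ x ∈ F.fil i j, Hs (n + 1) x = Hs n x := by
    intro n i hi
    refine heq i _ _ fun k hk j g => ?_
    rw [hHs, if_pos (lt_of_le_of_lt hk hi)]
  have hgood : ∀ n, ∀ i < n, ∀ j, good (Hs n) i j := by
    intro n
    induction n with
    | zero => intro i hi; omega
    | succ n ih =>
      have old : ∀ i < n, ∀ j, good (Hs (n + 1)) i j := by
        intro i hi j x hx
        have hδx := F.filBelow_le_fil _ _ (hδ i j x hx)
        rw [hstab n i hi j x hx, hstab n i hi _ _ hδx]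
        exact ih i hi j x hx
      intro i hi j x hx
      rcases Nat.lt_succ_iff_lt_or_eq.1 hi with hi' | rfl
      · exact old i hi' j x hx
      · obtain ⟨g, hg⟩ := hsdec i j x hx
        have h1 : Hs (i + 1) (s i j g) ∈ B i j ∧
            f (Hs (i + 1) (s i j g)) = Hs (i + 1) (δ (s i j g)) + ω (s i j g) := by
          rw [hHs, if_neg (lt_irrefl i)]
          have hδx := hδ i j _ (hsmem i j g)
          have hst : Hs (i + 1) (δ (s i j g)) = Hs i (δ (s i j g)) := by
            cases i with
            | zero => rw [(Submodule.mem_bot R).1 hδx, map_zero, map_zero]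
            | succ i => exact hstab _ i (Nat.lt_succ_self i) _ _ hδx
          rw [hst]
          exact hT (Hs i) i j (fun k hk => ih k hk _) g
        have h2 : Hs (i + 1) (x - s i j g) ∈ B i j ∧
            f (Hs (i + 1) (x - s i j g)) =
              Hs (i + 1) (δ (x - s i j g)) + ω (x - s i j g) := by
          cases i with
          | zero => rw [(Submodule.mem_bot R).1 hg]; simp
          | succ i =>
            have := old i (Nat.lt_succ_self i) j _ hg
            exact ⟨hB i j this.1, this.2⟩
        rw [← sub_add_cancel x (s i j g)]
        refine ⟨by rw [map_add]; exact Submodule.add_mem _ h2.1 h1.1, ?_⟩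
        rw [map_add, map_add, h1.2, h2.2]
        simp only [map_add]
        abel
  -- The values on each filtration step stabilise, so the sequence `Hs` has a limit.
  obtain ⟨H, hH⟩ : ∃ H : F.carrier →ₗ[R] C, ∀ i j, ∀ x ∈ F.fil i j, H x = Hs (i + 1) x := by
    have hstab' : ∀ n i j, ∀ x ∈ F.fil i j, i < n → Hs n x = Hs (i + 1) x := by
      intro n i j x hx hi
      induction n with
      | zero => omega
      | succ n ih =>
        rcases Nat.lt_succ_iff_lt_or_eq.1 hi with hi' | rfl
        · rw [hstab n i hi' j x hx, ih hi']
        · rfl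
    refine ⟨ext fun i j => Hs (i + 1) ∘ₗ s i j, fun i => heq i _ _ fun k hk j g => ?_⟩
    rw [hext, hstab' (i + 1) k j _ (hsmem k j g) (by omega)]
    rfl
  refine ⟨H, fun i j x hx => ?_, ?_⟩
  · rw [hH i j x hx]
    exact (hgood (i + 1) i (Nat.lt_succ_self i) j x hx).1
  · refine F.eqOn_fil_ext (f := f ∘ₗ H) (g := H ∘ₗ δ + ω) fun i j x hx => ?_
    have hδx := F.filBelow_le_fil _ _ (hδ i j x hx)
    change f (H x) = H (δ x) + ω x
    rw [hH i j x hx, hH i _ _ hδx]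
    exact (hgood (i + 1) i (Nat.lt_succ_self i) j x hx).2

end DiffFlag

/-! ### Anchored resolutions and filtered acyclicity of the cone -/

namespace DiffMod

variable {R : Type u} [CommRing R] {d : ℕ}

theorem Hom.isQuasiIso_iff {D : DiffMod.{u, v} R d} {E : DiffMod.{u, w} R d} (f : Hom D E) :
    f.IsQuasiIso ↔
      (∀ j, ∀ x ∈ D.deg j, D.diff x = 0 → ∀ k ∈ E.deg (j + 1), E.diff k = f.toLin x →
        ∃ y ∈ D.deg (j + 1), D.diff y = x) ∧
      (∀ j, ∀ z ∈ E.deg j, E.diff z = 0 → ∃ c ∈ D.deg j, D.diff c = 0 ∧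
        ∃ k ∈ E.deg (j + 1), E.diff k = f.toLin c - z) := by
  constructor
  · intro h
    refine ⟨fun j x hx hdx k hk hkx => ?_, fun j z hz hdz => ?_⟩
    · have h1 : f.homologyMap j (Submodule.Quotient.mk ⟨x, hdx, hx⟩) = 0 :=
        (Submodule.Quotient.mk_eq_zero _).2 ⟨k, hk, hkx⟩
      exact (Submodule.Quotient.mk_eq_zero _).1 ((map_eq_zero_iff _ (h j).1).1 h1)
    · obtain ⟨c, hc⟩ := (h j).2 (Submodule.Quotient.mk ⟨z, hdz, hz⟩)
      obtain ⟨⟨c, hc1, hc2⟩, rfl⟩ := Submodule.Quotient.mk_surjective _ c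
      obtain ⟨k, hk, hkc⟩ :=
        (Submodule.Quotient.eq ((E.boundaries j).submoduleOf (E.cycles j))).1 hc
      exact ⟨c, hc2, hc1, k, hk, hkc⟩
  · rintro ⟨h1, h2⟩ j
    constructor
    · rw [injective_iff_map_eq_zero]
      intro x hx
      obtain ⟨⟨x, hx1, hx2⟩, rfl⟩ := Submodule.Quotient.mk_surjective _ x
      obtain ⟨k, hk, hkx⟩ := (Submodule.Quotient.mk_eq_zero _).1 hx
      exact (Submodule.Quotient.mk_eq_zero _).2 (h1 j x hx2 hx1 k hk hkx)
    · intro z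
      obtain ⟨⟨z, hz1, hz2⟩, rfl⟩ := Submodule.Quotient.mk_surjective _ z
      obtain ⟨c, hc, hdc, k, hk, hkc⟩ := h2 j z hz2 hz1
      refine ⟨Submodule.Quotient.mk ⟨c, hdc, hc⟩, ?_⟩
      exact (Submodule.Quotient.eq ((E.boundaries j).submoduleOf (E.cycles j))).2 ⟨k, hk, hkc⟩

end DiffMod

namespace DiffFlag

variable {R : Type u} [CommRing R] {d : ℕ}

/-- The augmentation `F → D` has a cone which is acyclic in a filtered way: a cycle of the cone
in filtration `i - 1` is the boundary of an element of filtration `i`. -/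
def ConeAcyclic (F : DiffFlag.{u, v} R d) {D : DiffMod.{u, w} R d}
    (a : DiffMod.Hom F.toDiffMod D) : Prop :=
  ∀ i j, ∀ z ∈ F.filBelow i j, ∀ ζ ∈ D.deg (j + 1), F.diff z = 0 → D.diff ζ = a.toLin z →
    ∃ y ∈ F.fil i (j + 1), ∃ k ∈ D.deg (j + 1 + 1), F.diff y = z ∧ D.diff k = a.toLin y - ζ

/-- Exactness of the anchor in positive degrees, expressed inside the flag. -/
def AnchorExact (F : DiffFlag.{u, v} R d) : Prop :=
  ∀ n j, ∀ x ∈ F.fil (n + 1) j, F.diff x ∈ F.filBelow n (j - 1) →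
    ∃ y ∈ F.fil (n + 2) (j + 1), x - F.diff y ∈ F.fil n j

theorem anchorExact_of_exact {F : DiffFlag.{u, v} R d}
    (h : ∀ j n, Function.Exact (F.anchorDiff j (n + 1)) (F.anchorDiff j n)) : F.AnchorExact := by
  intro n j x hx hdx
  obtain ⟨t, rfl⟩ : ∃ t, j = ((n + 1 : ℕ) : ZMod d) + t := ⟨j - ((n + 1 : ℕ) : ZMod d), by ring⟩
  have e : ((n + 1 : ℕ) : ZMod d) + t - 1 = (n : ZMod d) + t := by push_cast; ring
  have e' : ((n + 1 : ℕ) : ZMod d) + t + 1 = ((n + 2 : ℕ) : ZMod d) + t := by push_cast; ring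
  rw [e] at hdx
  have h0 : F.anchorDiff t n (Submodule.Quotient.mk ⟨x, hx⟩) = 0 :=
    (Submodule.Quotient.mk_eq_zero _).2 hdx
  obtain ⟨y, hy⟩ := (h t n _).1 h0
  obtain ⟨⟨y, hy'⟩, rfl⟩ := Submodule.Quotient.mk_surjective _ y
  refine ⟨y, e' ▸ hy', ?_⟩
  exact (Submodule.Quotient.eq
    ((F.filBelow (n + 1) (((n + 1 : ℕ) : ZMod d) + t)).submoduleOf (F.fil (n + 1) _))).1 hy.symm

/-- The leading term of a cycle is a cycle of the anchor, hence a boundary as long as its filtration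
is positive; subtracting the boundary lowers the filtration. -/
theorem AnchorExact.exists_sub_mem_fil_zero {F : DiffFlag.{u, v} R d} (h : F.AnchorExact)
    (n : ℕ) (j : ZMod d) (x : F.carrier) (hx : x ∈ F.fil n j) (hdx : F.diff x = 0) :
    ∃ y ∈ F.fil (n + 1) (j + 1), x - F.diff y ∈ F.fil 0 j := by
  induction n generalizing x with
  | zero => exact ⟨0, Submodule.zero_mem _, by simpa using hx⟩
  | succ n ih =>
    obtain ⟨y, hy, hxy⟩ := h n j x hx (by rw [hdx]; exact Submodule.zero_mem _)
    obtain ⟨y', hy', hxy'⟩ := ih _ hxy (by rw [map_sub, hdx, F.diff_diff, sub_zero])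
    refine ⟨y + y', Submodule.add_mem _ hy (F.fil_mono _ _ hy'), ?_⟩
    rwa [map_add, ← sub_sub]

/-- When `y` has filtration above `i`, its leading term is a cycle of the anchor. Subtracting a
boundary from `y` lowers its filtration and leaves `∂y` unchanged. -/
theorem AnchorExact.exists_diff_eq {F : DiffFlag.{u, v} R d} (h : F.AnchorExact) (i : ℕ)
    (j : ZMod d) (z : F.carrier) (hz : z ∈ F.filBelow i j) (m : ℕ) (y : F.carrier)
    (hy : y ∈ F.fil (i + m) (j + 1)) (hyz : F.diff y = z) :
    ∃ y' ∈ F.fil i (j + 1), F.diff y' = z := by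
  induction m generalizing y with
  | zero => exact ⟨y, hy, hyz⟩
  | succ m ih =>
    obtain ⟨w, -, hw⟩ := h (i + m) (j + 1) y hy (by
      rw [hyz, add_sub_cancel_right]
      rcases Nat.eq_zero_or_pos m with rfl | hm
      · exact hz
      · exact F.fil_le_filBelow _ (by omega) (F.filBelow_le_fil _ _ hz))
    exact ih _ hw (by rw [map_sub, F.diff_diff, sub_zero, hyz])

/-- Injectivity on homology gives `y₁` with `∂y₁ = z`, which can be pushed down to filtration `i`.
Then `a y₁ - ζ` is a cycle of `D`, homologous to `a c` for a cycle `c`; moving `c` to filtration `0`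
allows it to be subtracted from `y₁` for every `i`. -/
theorem AnchorExact.coneAcyclic {F : DiffFlag.{u, v} R d} (h : F.AnchorExact)
    {D : DiffMod.{u, w} R d} {a : DiffMod.Hom F.toDiffMod D} (ha : a.IsQuasiIso) :
    F.ConeAcyclic a := by
  intro i j z hz ζ hζ hdz hζz
  obtain ⟨hinj, hsurj⟩ := a.isQuasiIso_iff.1 ha
  obtain ⟨y₀, hy₀, rfl⟩ :=
    hinj j z (F.fil_le_deg _ _ (F.filBelow_le_fil _ _ hz)) hdz ζ hζ hζz
  obtain ⟨m, hm⟩ := F.fil_exhaustive _ y₀ hy₀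
  obtain ⟨y₁, hy₁, hyy⟩ := h.exists_diff_eq i j _ hz m y₀
    (F.fil_le_of_le _ (Nat.le_add_left m i) hm) rfl
  obtain ⟨c, hc, hdc, k, hk, hkc⟩ := hsurj (j + 1) (a.toLin y₁ - ζ)
    (Submodule.sub_mem _ (a.mem_deg _ _ (F.fil_le_deg _ _ hy₁)) hζ)
    (by rw [map_sub, a.comm, hyy, hζz, sub_self])
  obtain ⟨n, hn⟩ := F.fil_exhaustive _ c hc
  obtain ⟨b, hb, hcb⟩ := h.exists_sub_mem_fil_zero n _ c hn hdc
  refine ⟨y₁ - (c - F.diff b), Submodule.sub_mem _ hy₁ (F.fil_le_of_le _ (Nat.zero_le i) hcb),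
    a.toLin b - k, Submodule.sub_mem _ (a.mem_deg _ _ (F.fil_le_deg _ _ hb)) hk, ?_, ?_⟩
  · simp [hyy, hdc, F.diff_diff]
  · simp only [map_sub, a.comm, hkc]
    abel

/-- The differential of the cone of `a : F → D`. -/
def coneDiff (F : DiffFlag.{u, v} R d) {D : DiffMod.{u, w} R d}
    (a : DiffMod.Hom F.toDiffMod D) :
    (F.carrier × D.carrier) →ₗ[R] (F.carrier × D.carrier) :=
  LinearMap.prod (F.diff ∘ₗ LinearMap.fst R _ _)
    (a.toLin ∘ₗ LinearMap.fst R _ _ - D.diff ∘ₗ LinearMap.snd R _ _)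

theorem ConeAcyclic.exists_coneDiff_eq {F : DiffFlag.{u, v} R d} {D : DiffMod.{u, w} R d}
    {a : DiffMod.Hom F.toDiffMod D} (h : F.ConeAcyclic a) (i : ℕ) (j j' j'' : ZMod d)
    (hj' : j + 1 = j') (hj'' : j' + 1 = j'') :
    ∀ c ∈ (F.filBelow i j).prod (D.deg j'), F.coneDiff a c = 0 →
      ∃ b ∈ (F.fil i j').prod (D.deg j''), F.coneDiff a b = c := by
  subst hj' hj''
  rintro ⟨z, ζ⟩ ⟨hz, hζ⟩ hc
  have h1 : F.diff z = 0 := congrArg Prod.fst hc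
  have h2 : a.toLin z - D.diff ζ = 0 := congrArg Prod.snd hc
  obtain ⟨y, hy, k, hk, hyz, hky⟩ := h i j z hz ζ hζ h1 (sub_eq_zero.1 h2).symm
  refine ⟨(y, k), ⟨hy, hk⟩, Prod.ext hyz ?_⟩
  change a.toLin y - D.diff k = ζ
  rw [hky, sub_sub_cancel]

/-! ### Comparison morphisms and homotopies -/

theorem mem_deg_of_mem_fil (F : DiffFlag.{u, v} R d) {C : Type w} [AddCommGroup C] [Module R C]
    (f : F.carrier →ₗ[R] C) (j : ZMod d) (S : Submodule R C)
    (h : ∀ i, ∀ x ∈ F.fil i j, f x ∈ S) : ∀ x ∈ F.deg j, f x ∈ S := by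
  intro x hx
  obtain ⟨i, hi⟩ := F.fil_exhaustive j x hx
  exact h i x hi

/-- A solution `H = (f, η)` with values in the cone of `b`, for `ω = (0, a)`, contains both data:
the first component of the equation says that `f` is a morphism, the second that `b f - a = ∂η +
η∂`. -/
theorem IsProjective.exists_hom {F : DiffFlag.{u, v} R d} (hF : F.IsProjective)
    {G : DiffFlag.{u, w} R d} {D : DiffMod.{u, w'} R d} (a : DiffMod.Hom F.toDiffMod D)
    {b : DiffMod.Hom G.toDiffMod D} (hG : G.ConeAcyclic b) :
    ∃ f : Hom F G, DiffMod.Hom.Homotopic (b.comp f.toHom) a := by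
  obtain ⟨H, hHB, hH⟩ := hF.exists_solution (G.coneDiff b) F.diff F.diff_diff
    (fun i j x hx => F.diff_mem_filBelow_sub_one hx)
    (fun i j => (G.filBelow i (j - 1)).prod (D.deg j))
    (fun i j => (G.fil i j).prod (D.deg (j + 1)))
    (fun i j => hG.exists_coneDiff_eq i _ _ _ (by ring) rfl)
    (fun i j => Submodule.prod_mono le_rfl (by rw [sub_add_cancel]))
    (fun i j => Submodule.prod_mono (G.fil_mono i j) le_rfl)
    (LinearMap.inr R _ _ ∘ₗ a.toLin)
    (fun i j x hx => ⟨Submodule.zero_mem _, a.mem_deg _ _ (F.fil_le_deg _ _ hx)⟩)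
    (fun x => by
      refine Prod.ext ?_ ?_
      · simp [coneDiff]
      · simp [coneDiff, a.comm])
  have h1 : ∀ x, G.diff (H x).1 = (H (F.diff x)).1 := fun x =>
    (congrArg Prod.fst (hH x)).trans (by simp)
  have h2 : ∀ x, b.toLin (H x).1 - D.diff (H x).2 = (H (F.diff x)).2 + a.toLin x := fun x =>
    (congrArg Prod.snd (hH x)).trans (by simp)
  refine ⟨{ toLin := LinearMap.fst R _ _ ∘ₗ H
            comm := h1
            mem_deg := fun j => F.mem_deg_of_mem_fil _ j _ fun i x hx =>
              G.fil_le_deg _ _ (hHB i j x hx).1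
            mem_fil := fun i j x hx => (hHB i j x hx).1 },
    LinearMap.snd R _ _ ∘ₗ H, fun j => F.mem_deg_of_mem_fil _ j _ fun i x hx =>
      (hHB i j x hx).2, fun x => ?_⟩
  change b.toLin (H x).1 - a.toLin x = D.diff (H x).2 + (H (F.diff x)).2
  rw [sub_eq_iff_eq_add.1 (h2 x)]
  abel

/-- The same method with `ω = (f - g, η)`. A homotopy anticommutes with the differential, whence `δ
= -∂`. The second component of the solution is discarded, but it is needed for the obstructions to
be cycles of the acyclic cone. -/
theorem IsProjective.homotopic {F : DiffFlag.{u, v} R d} (hF : F.IsProjective)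
    {G : DiffFlag.{u, w} R d} {D : DiffMod.{u, w'} R d}
    {b : DiffMod.Hom G.toDiffMod D} (hG : G.ConeAcyclic b) (f g : Hom F G)
    (hfg : DiffMod.Hom.Homotopic (b.comp f.toHom) (b.comp g.toHom)) : f.Homotopic g := by
  obtain ⟨η, hηdeg, hη⟩ := hfg
  have hη' : ∀ x, b.toLin (f.toLin x) - b.toLin (g.toLin x) = D.diff (η x) + η (F.diff x) := hη
  obtain ⟨H, hHB, hH⟩ := hF.exists_solution (G.coneDiff b) (-F.diff)
    (fun x => by simp [F.diff_diff])
    (fun i j x hx => Submodule.neg_mem _ (F.diff_mem_filBelow_sub_one hx))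
    (fun i j => (G.fil i j).prod (D.deg (j + 1)))
    (fun i j => (G.fil (i + 1) (j + 1)).prod (D.deg (j + 1 + 1)))
    (fun i j => hG.exists_coneDiff_eq (i + 1) _ _ _ rfl rfl)
    (fun i j => by rw [sub_add_cancel])
    (fun i j => Submodule.prod_mono (G.fil_mono _ _) le_rfl)
    ((f.toLin - g.toLin).prod η)
    (fun i j x hx => ⟨Submodule.sub_mem _ (f.mem_fil _ _ _ hx) (g.mem_fil _ _ _ hx),
      hηdeg _ _ (F.fil_le_deg _ _ hx)⟩)
    (fun x => by
      refine Prod.ext ?_ ?_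
      · simp [coneDiff, f.comm, g.comm, neg_add_eq_sub]
      · simp [coneDiff, hη'])
  refine ⟨LinearMap.fst R _ _ ∘ₗ H, fun i j x hx => (hHB i j x hx).1, fun x => ?_⟩
  have h1 : G.diff (H x).1 = (H (-F.diff x)).1 + (f.toLin x - g.toLin x) :=
    congrArg Prod.fst (hH x)
  change _ = G.diff (H x).1 + (H (F.diff x)).1
  rw [h1, map_neg, Prod.fst_neg]
  abel

end DiffFlag

namespace DiffMod.Hom

variable {R : Type u} [CommRing R] {d : ℕ} {D : DiffMod.{u, v} R d} {E : DiffMod.{u, w} R d}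

theorem Homotopic.symm {f g : Hom D E} (h : f.Homotopic g) : g.Homotopic f := by
  obtain ⟨η, h1, h2⟩ := h
  refine ⟨-η, fun j x hx => Submodule.neg_mem _ (h1 j x hx), fun x => ?_⟩
  rw [← neg_sub, h2]
  simp only [LinearMap.neg_apply, map_neg]
  abel

theorem Homotopic.trans {f g k : Hom D E} (h : f.Homotopic g) (h' : g.Homotopic k) :
    f.Homotopic k := by
  obtain ⟨η, h1, h2⟩ := h
  obtain ⟨η', h1', h2'⟩ := h'
  refine ⟨η + η', fun j x hx => Submodule.add_mem _ (h1 j x hx) (h1' j x hx), fun x => ?_⟩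
  rw [← sub_add_sub_cancel _ (g.toLin x), h2, h2']
  simp only [LinearMap.add_apply, map_add]
  abel

theorem Homotopic.comp_right {f g : Hom D E} (h : f.Homotopic g) {C : DiffMod.{u, w'} R d}
    (k : Hom C D) : (f.comp k).Homotopic (g.comp k) := by
  obtain ⟨η, h1, h2⟩ := h
  refine ⟨η ∘ₗ k.toLin, fun j x hx => h1 j _ (k.mem_deg j x hx), fun x => ?_⟩
  change f.toLin (k.toLin x) - g.toLin (k.toLin x) = E.diff (η (k.toLin x)) + η (k.toLin (C.diff x))
  rw [h2, k.comm]

end DiffMod.Hom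

namespace FlagResolution

variable {R : Type u} [CommRing R] {d : ℕ} {D : DiffMod.{u, v} R d}

theorem IsAnchored.coneAcyclic {F : FlagResolution.{u, v, w} D} (hF : F.IsAnchored) :
    F.flag.ConeAcyclic F.aug :=
  (DiffFlag.anchorExact_of_exact fun j n => by
    obtain ⟨ε, hε⟩ := hF j
    exact hε.exact_succ n).coneAcyclic F.isQuasiIso

theorem IsAnchored.exists_respectsAug (F : FlagResolution.{u, v, w} D)
    {G : FlagResolution.{u, v, w'} D} (hG : G.IsAnchored) :
    ∃ f : DiffFlag.Hom F.flag G.flag, RespectsAug f :=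
  F.isProjective.exists_hom F.aug hG.coneAcyclic

theorem RespectsAug.comp {F : FlagResolution.{u, v, w} D} {G : FlagResolution.{u, v, w'} D}
    {K : FlagResolution.{u, v, w''} D} {f : DiffFlag.Hom F.flag G.flag}
    {g : DiffFlag.Hom G.flag K.flag} (hg : RespectsAug g) (hf : RespectsAug f) :
    RespectsAug (g.comp f) :=
  (DiffMod.Hom.Homotopic.comp_right hg f.toHom).trans hf

/-- A flag-preserving endomorphism of an anchored resolution which respects the augmentation is
homotopic to the identity. -/
theorem IsAnchored.homotopic_id {F : FlagResolution.{u, v, w} D} (hF : F.IsAnchored)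
    {f : DiffFlag.Hom F.flag F.flag} (hf : RespectsAug f) :
    f.Homotopic (DiffFlag.Hom.id F.flag) :=
  F.isProjective.homotopic hF.coneAcyclic f _ hf

end FlagResolution

/-! ### Finiteness of minimal free resolutions -/

section LocalRing

variable {R : Type u} [CommRing R] [IsLocalRing R]

/-- A basis vector involved in no generator of `N` would have its coordinate function mapping all of
`N + 𝔪C = C` into `𝔪`, although it takes the value `1`. So the basis is finite. Nakayama's lemma is
not available before `C` is known to be finite. -/
theorem Module.Free.finite_of_sup_smul_top_eq_top {C : Type v} [AddCommGroup C] [Module R C]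
    [Module.Free R C] {N : Submodule R C} (hN : N.FG)
    (h : N ⊔ IsLocalRing.maximalIdeal R • ⊤ = ⊤) : Module.Finite R C := by
  classical
  let b := Module.Free.chooseBasis R C
  obtain ⟨s, rfl⟩ := hN
  let T := s.biUnion fun x => (b.repr x).support
  have hT : ∀ i, i ∈ T := by
    intro i
    by_contra hi
    have hle : Submodule.span R (s : Set C) ⊔ IsLocalRing.maximalIdeal R • ⊤ ≤
        Submodule.comap (b.coord i) (IsLocalRing.maximalIdeal R) := by
      refine sup_le (Submodule.span_le.2 fun x hx => ?_) (Submodule.smul_le.2 fun r hr x _ => ?_)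
      · have : b.repr x i = 0 := by
          by_contra h0
          exact hi (Finset.mem_biUnion.2 ⟨x, hx, Finsupp.mem_support_iff.2 h0⟩)
        change b.coord i x ∈ IsLocalRing.maximalIdeal R
        rw [Module.Basis.coord_apply, this]
        exact Ideal.zero_mem _
      · change b.coord i (r • x) ∈ IsLocalRing.maximalIdeal R
        rw [map_smul, smul_eq_mul]
        exact Ideal.mul_mem_right _ _ hr
    have h1 : b i ∈ Submodule.comap (b.coord i) (IsLocalRing.maximalIdeal R) :=
      hle (by rw [h]; exact Submodule.mem_top)
    have h2 : b.coord i (b i) ∈ IsLocalRing.maximalIdeal R := h1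
    rw [Module.Basis.coord_apply, b.repr_self, Finsupp.single_eq_same] at h2
    exact (Ideal.ne_top_iff_one _).1 (IsLocalRing.maximalIdeal.isMaximal R).ne_top h2
  have : Fintype (Module.Free.ChooseBasisIndex R C) := ⟨T, hT⟩
  exact Module.Finite.of_basis b

theorem Module.Free.finite_of_surjective_of_ker_le {C : Type v} [AddCommGroup C] [Module R C]
    [Module.Free R C] {M : Type w} [AddCommGroup M] [Module R M] [Module.Finite R M]
    (f : C →ₗ[R] M) (hf : Function.Surjective f)
    (hker : LinearMap.ker f ≤ IsLocalRing.maximalIdeal R • ⊤) : Module.Finite R C := by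
  classical
  obtain ⟨s, hs⟩ := Module.Finite.fg_top (R := R) (M := M)
  obtain ⟨g, hg⟩ := hf.hasRightInverse
  refine Module.Free.finite_of_sup_smul_top_eq_top
    (N := Submodule.span R ((s.image g : Finset C) : Set C)) ⟨_, rfl⟩ (top_le_iff.1 ?_)
  refine le_trans ?_ (sup_le_sup_left hker _)
  rw [← Submodule.comap_map_eq, Submodule.map_span, Finset.coe_image, ← Set.image_comp,
    show f ∘ g = id from funext hg, Set.image_id, hs, Submodule.comap_top]

theorem IsMinimalFreeResolution.finite [IsNoetherianRing R] {C : ℕ → Type v}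
    [∀ n, AddCommGroup (C n)] [∀ n, Module R (C n)] {δ : ∀ n, C (n + 1) →ₗ[R] C n}
    {M : Type w} [AddCommGroup M] [Module R M] [Module.Finite R M] {ε : C 0 →ₗ[R] M}
    (h : IsMinimalFreeResolution C δ ε) (n : ℕ) : Module.Finite R (C n) := by
  have := h.free
  induction n with
  | zero =>
    refine Module.Free.finite_of_surjective_of_ker_le ε h.surjective ?_
    rw [LinearMap.exact_iff.1 h.exact_zero]
    exact h.minimal 0
  | succ n ih =>
    refine Module.Free.finite_of_surjective_of_ker_le (δ n).rangeRestrict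
      (LinearMap.surjective_rangeRestrict _) ?_
    rw [LinearMap.ker_rangeRestrict, LinearMap.exact_iff.1 (h.exact_succ n)]
    exact h.minimal (n + 1)

end LocalRing

/-! ### Minimal flags and Nakayama's lemma -/

namespace DiffFlag

variable {R : Type u} [CommRing R] {d : ℕ}

/-- Minimality of the anchor, expressed inside the flag. -/
def IsMinimal [IsLocalRing R] (F : DiffFlag.{u, v} R d) : Prop :=
  ∀ n j, ∀ x ∈ F.fil (n + 1) j,
    F.diff x ∈ IsLocalRing.maximalIdeal R • F.fil n (j - 1) ⊔ F.filBelow n (j - 1)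

theorem mk_mem_smul_top_iff (F : DiffFlag.{u, v} R d) (I : Ideal R) (i : ℕ) (j : ZMod d)
    (x : F.fil i j) :
    (Submodule.Quotient.mk x : F.gr i j) ∈ I • (⊤ : Submodule R (F.gr i j)) ↔
      (x : F.carrier) ∈ I • F.fil i j ⊔ F.filBelow i j := by
  have hmap : (I • (⊤ : Submodule R (F.fil i j))).map (F.fil i j).subtype = I • F.fil i j := by
    rw [Submodule.map_smul'', Submodule.map_top, Submodule.range_subtype]
  have htop : (I • (⊤ : Submodule R (F.fil i j))).map
      ((F.filBelow i j).submoduleOf (F.fil i j)).mkQ = I • ⊤ := by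
    rw [Submodule.map_smul'', Submodule.map_top, Submodule.range_mkQ]
  rw [← htop, ← hmap]
  constructor
  · rintro ⟨y, hy, hyx⟩
    have hxy := (Submodule.Quotient.eq ((F.filBelow i j).submoduleOf (F.fil i j))).1 hyx.symm
    rw [← add_sub_cancel (y : F.carrier) (x : F.carrier)]
    exact Submodule.add_mem_sup ⟨y, hy, rfl⟩ hxy
  · intro hx
    obtain ⟨_, ⟨y, hy, rfl⟩, z, hz, hyz⟩ := Submodule.mem_sup.1 hx
    refine ⟨y, hy, ((Submodule.Quotient.eq ((F.filBelow i j).submoduleOf (F.fil i j))).2 ?_)⟩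
    change (y : F.carrier) - x ∈ F.filBelow i j
    rw [← hyz]
    simpa using hz

theorem isMinimal_iff [IsLocalRing R] {F : DiffFlag.{u, v} R d} :
    F.IsMinimal ↔ ∀ j n, LinearMap.range (F.anchorDiff j n) ≤
      IsLocalRing.maximalIdeal R • (⊤ : Submodule R (F.anchor j n)) := by
  have e (n : ℕ) (t : ZMod d) : ((n + 1 : ℕ) : ZMod d) + t - 1 = (n : ZMod d) + t := by
    push_cast; ring
  constructor
  · rintro h j n _ ⟨x, rfl⟩
    obtain ⟨⟨x, hx⟩, rfl⟩ := Submodule.Quotient.mk_surjective _ x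
    refine (F.mk_mem_smul_top_iff _ n _ _).2 ?_
    have := h n _ x hx
    rwa [e] at this
  · intro h n j x hx
    obtain ⟨t, rfl⟩ : ∃ t, j = ((n + 1 : ℕ) : ZMod d) + t :=
      ⟨j - ((n + 1 : ℕ) : ZMod d), by ring⟩
    rw [e]
    exact (F.mk_mem_smul_top_iff _ n _ ⟨F.diff x, F.diff_mem_anchor t n x hx⟩).1
      (h t n ⟨Submodule.Quotient.mk ⟨x, hx⟩, rfl⟩)

theorem finite_fil {F : DiffFlag.{u, v} R d} (h : ∀ i j, Module.Finite R (F.gr i j)) (i : ℕ)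
    (j : ZMod d) : Module.Finite R (F.fil i j) := by
  have key : ∀ i j, Module.Finite R (F.filBelow i j) → Module.Finite R (F.fil i j) := by
    intro i j hfin
    have := Module.Finite.equiv (Submodule.submoduleOfEquivOfLe (F.filBelow_le_fil i j)).symm
    have := h i j
    exact Module.Finite.of_submodule_quotient ((F.filBelow i j).submoduleOf (F.fil i j))
  induction i with
  | zero => exact key 0 j (inferInstanceAs (Module.Finite R (⊥ : Submodule R F.carrier)))
  | succ i ih => exact key _ j ih

theorem map_smul_sup_filBelow_le {F : DiffFlag.{u, v} R d} (I : Ideal R)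
    (h : F.carrier →ₗ[R] F.carrier) (hh : ∀ i j, ∀ x ∈ F.fil i j, h x ∈ F.fil (i + 1) (j + 1))
    (n : ℕ) (j : ZMod d) :
    ∀ x ∈ I • F.fil n j ⊔ F.filBelow n j,
      h x ∈ I • F.fil (n + 1) (j + 1) ⊔ F.filBelow (n + 1) (j + 1) := by
  have hle : I • F.fil n j ⊔ F.filBelow n j ≤
      (I • F.fil (n + 1) (j + 1) ⊔ F.filBelow (n + 1) (j + 1)).comap h := by
    refine sup_le (Submodule.smul_le.2 fun r hr x hx => ?_) fun x hx => ?_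
    · rw [Submodule.mem_comap, map_smul]
      exact Submodule.mem_sup_left (Submodule.smul_mem_smul hr (hh n j x hx))
    · refine Submodule.mem_sup_right ?_
      cases n with
      | zero =>
        rw [(Submodule.mem_bot R).1 hx, map_zero]
        exact Submodule.zero_mem _
      | succ n => exact hh n j x hx
  exact hle

theorem Hom.ext {F : DiffFlag.{u, v} R d} {G : DiffFlag.{u, w} R d} {f g : Hom F G}
    (h : f.toLin = g.toLin) : f = g := by
  obtain ⟨⟨f, _, _⟩, _⟩ := f
  obtain ⟨⟨g, _, _⟩, _⟩ := g
  cases h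
  rfl

variable [IsLocalRing R]

/-- On graded pieces `h` has degree at most `1` and `∂` has image in `𝔪`, so both `∂h` and `h∂`
vanish modulo `𝔪`. -/
theorem IsMinimal.sub_mem {F : DiffFlag.{u, v} R d} (hF : F.IsMinimal) {f : Hom F F}
    (hf : f.Homotopic (Hom.id F)) (i : ℕ) (j : ZMod d) (x : F.carrier) (hx : x ∈ F.fil i j) :
    f.toLin x - x ∈ IsLocalRing.maximalIdeal R • F.fil i j ⊔ F.filBelow i j := by
  obtain ⟨h, hh, hfh⟩ := hf
  have e : f.toLin x - x = F.diff (h x) + h (F.diff x) := hfh x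
  rw [e]
  refine Submodule.add_mem _ ?_ ?_
  · have := hF i (j + 1) (h x) (hh i j x hx)
    rwa [add_sub_cancel_right] at this
  · cases i with
    | zero =>
      rw [F.diff_fil_zero j x hx, map_zero]
      exact Submodule.zero_mem _
    | succ i =>
      have := map_smul_sup_filBelow_le _ h hh i (j - 1) _ (hF i j x hx)
      rwa [sub_add_cancel] at this

/-- By `IsMinimal.sub_mem`, an element of `F^i_j` is in the image of `f` up to `𝔪 F^i_j` and
`F^{i-1}_j`; the latter is in the image by induction, and Nakayama's lemma removes the former. -/
theorem IsMinimal.map_fil_eq {F : DiffFlag.{u, v} R d} (hF : F.IsMinimal)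
    (hfin : ∀ i j, Module.Finite R (F.gr i j)) {f : Hom F F} (hf : f.Homotopic (Hom.id F))
    (i : ℕ) (j : ZMod d) : F.fil i j ≤ (F.fil i j).map f.toLin := by
  have key : ∀ i j, F.filBelow i j ≤ (F.filBelow i j).map f.toLin →
      F.fil i j ≤ (F.fil i j).map f.toLin := by
    intro i j hle
    refine Submodule.le_of_le_smul_of_le_jacobson_bot (I := IsLocalRing.maximalIdeal R)
      (Module.Finite.iff_fg.1 (finite_fil hfin i j))
      (IsLocalRing.maximalIdeal_le_jacobson ⊥) fun x hx => ?_
    have h1 := hF.sub_mem hf i j x hx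
    obtain ⟨y, hy, z, hz, hyz⟩ := Submodule.mem_sup.1 h1
    have hx' : x = (f.toLin x - z) + -y := by
      rw [← sub_eq_add_neg, sub_sub, add_comm z y, hyz, sub_sub_cancel]
    rw [hx']
    refine Submodule.add_mem_sup (Submodule.sub_mem _ ⟨x, hx, rfl⟩ ?_) (Submodule.neg_mem _ hy)
    exact Submodule.map_mono (F.filBelow_le_fil i j) (hle hz)
  induction i with
  | zero => exact key 0 j bot_le
  | succ i ih => exact key (i + 1) j ih

/-- On each finitely generated `F^i_j` the map is a surjective endomorphism, hence injective. The
whole flag need not be finitely generated, so this is done step by step. -/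
theorem IsMinimal.bijective {F : DiffFlag.{u, v} R d} (hF : F.IsMinimal)
    (hfin : ∀ i j, Module.Finite R (F.gr i j)) {f : Hom F F} (hf : f.Homotopic (Hom.id F)) :
    Function.Bijective f.toLin := by
  classical
  have hinj : ∀ j, ∀ x ∈ F.deg j, f.toLin x = 0 → x = 0 := by
    intro j x hx hfx
    obtain ⟨i, hi⟩ := F.fil_exhaustive j x hx
    have := finite_fil hfin i j
    have hsurj : Function.Surjective (f.toLin.restrict (f.mem_fil i j)) := by
      rintro ⟨y, hy⟩
      obtain ⟨z, hz, hzy⟩ := hF.map_fil_eq hfin hf i j hy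
      exact ⟨⟨z, hz⟩, Subtype.ext hzy⟩
    have h0 : (⟨x, hi⟩ : F.fil i j) = 0 :=
      OrzechProperty.injective_of_surjective_endomorphism _ hsurj
        ((Subtype.ext hfx : f.toLin.restrict (f.mem_fil i j) ⟨x, hi⟩ = 0).trans (map_zero _).symm)
    exact congrArg Subtype.val h0
  constructor
  · rw [injective_iff_map_eq_zero]
    intro x hx
    let _ := F.isInternal.chooseDecomposition
    rw [← DirectSum.sum_support_decompose F.deg x] at hx ⊢
    rw [map_sum] at hx
    have h0 := (iSupIndep_iff_finsetSum_eq_zero_imp_eq_zero F.deg).1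
      F.isInternal.submodule_iSupIndep _ _
      (fun j _ => f.mem_deg j _ (DirectSum.decompose F.deg x j).2) hx
    exact Finset.sum_eq_zero fun j hj => hinj j _ (DirectSum.decompose F.deg x j).2 (h0 j hj)
  · rw [← LinearMap.range_eq_top, eq_top_iff, ← F.isInternal.submodule_iSup_eq_top]
    refine iSup_le fun j x hx => ?_
    obtain ⟨i, hi⟩ := F.fil_exhaustive j x hx
    obtain ⟨y, -, hy⟩ := hF.map_fil_eq hfin hf i j hi
    exact ⟨y, hy⟩

theorem IsMinimal.exists_inverse {F : DiffFlag.{u, v} R d} (hF : F.IsMinimal)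
    (hfin : ∀ i j, Module.Finite R (F.gr i j)) {f : Hom F F} (hf : f.Homotopic (Hom.id F)) :
    ∃ g : Hom F F, g.comp f = Hom.id F ∧ f.comp g = Hom.id F := by
  have hbij := hF.bijective hfin hf
  let e := LinearEquiv.ofBijective f.toLin hbij
  have hfil : ∀ i j, ∀ x ∈ F.fil i j, e.symm x ∈ F.fil i j := by
    intro i j x hx
    obtain ⟨y, hy, rfl⟩ := hF.map_fil_eq hfin hf i j hx
    rwa [show e.symm (f.toLin y) = y from e.symm_apply_apply y]
  refine ⟨{ toLin := e.symm.toLinearMap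
            comm := fun x => ?_
            mem_deg := fun j => F.mem_deg_of_mem_fil _ j _ fun i x hx =>
              F.fil_le_deg _ _ (hfil i j x hx)
            mem_fil := hfil }, ?_, ?_⟩
  · apply hbij.1
    have h1 : ∀ y, f.toLin (e.symm y) = y := e.apply_symm_apply
    change f.toLin (F.diff (e.symm x)) = f.toLin (e.symm (F.diff x))
    rw [h1, ← f.comm, h1]
  · exact Hom.ext (LinearMap.ext e.symm_apply_apply)
  · exact Hom.ext (LinearMap.ext e.apply_symm_apply)

end DiffFlag

/-! ### Retractions onto quasiminimal resolutions -/

namespace FlagResolution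

variable {R : Type u} [CommRing R] [IsLocalRing R] {d : ℕ} {D : DiffMod.{u, v} R d}

theorem IsQuasiminimal.isMinimal {Q : FlagResolution.{u, v, w} D} (hQ : Q.IsQuasiminimal) :
    Q.flag.IsMinimal :=
  DiffFlag.isMinimal_iff.2 fun j n => (hQ j).elim fun _ h => h.minimal n

theorem IsQuasiminimal.finite_gr [IsNoetherianRing R] {Q : FlagResolution.{u, v, w} D}
    (hQ : Q.IsQuasiminimal) (hD : ∀ j, Module.Finite R (D.homology j)) (i : ℕ) (j : ZMod d) :
    Module.Finite R (Q.flag.gr i j) := by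
  obtain ⟨t, rfl⟩ : ∃ t, j = (i : ZMod d) + t := ⟨j - i, by ring⟩
  obtain ⟨ε, hε⟩ := hQ t
  have := hD t
  exact hε.finite i

/-- A morphism from a quasiminimal resolution which respects the augmentations has a
flag-preserving retraction. -/
theorem IsQuasiminimal.exists_retraction [IsNoetherianRing R] {Q : FlagResolution.{u, v, w} D}
    (hQ : Q.IsQuasiminimal) (hD : ∀ j, Module.Finite R (D.homology j))
    {F : FlagResolution.{u, v, w'} D} {f : DiffFlag.Hom Q.flag F.flag} (hf : RespectsAug f)
    {g : DiffFlag.Hom F.flag Q.flag} (hg : RespectsAug g) :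
    ∃ p : DiffFlag.Hom F.flag Q.flag, p.comp f = DiffFlag.Hom.id Q.flag ∧ RespectsAug p := by
  have hgf : RespectsAug (g.comp f) := hg.comp hf
  obtain ⟨k, hk, hk'⟩ := hQ.isMinimal.exists_inverse (hQ.finite_gr hD)
    (hQ.isAnchored.homotopic_id hgf)
  -- Precomposing the homotopy from `Q.aug ∘ (g f)` to `Q.aug` with the inverse `k` of `g f` gives
  -- one from `Q.aug` to `Q.aug ∘ k`.
  have hkaug : RespectsAug k := by
    have h : DiffMod.Hom.Homotopic
        ((Q.aug.comp (g.comp f).toHom).comp k.toHom) (Q.aug.comp k.toHom) :=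
      DiffMod.Hom.Homotopic.comp_right hgf k.toHom
    have h2 : (Q.aug.comp (g.comp f).toHom).comp k.toHom =
        Q.aug.comp (DiffFlag.Hom.id Q.flag).toHom := by
      rw [← hk']; rfl
    rw [h2] at h
    exact h.symm
  exact ⟨k.comp g, hk, hkaug.comp hg⟩

end FlagResolution

/-! ### Minimal covers and syzygies -/

section LocalRing

variable {R : Type u} [CommRing R]

theorem Finsupp.mem_smul_top_of_forall_mem {ι : Type w} (I : Ideal R) (x : ι →₀ R)
    (h : ∀ i, x i ∈ I) : x ∈ I • (⊤ : Submodule R (ι →₀ R)) := by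
  rw [← x.sum_single]
  refine Submodule.sum_mem _ fun i _ => ?_
  rw [← mul_one (x i), ← smul_eq_mul, ← Finsupp.smul_single]
  exact Submodule.smul_mem_smul (h i) trivial

variable [IsLocalRing R]

open TensorProduct in
/-- Finitely generated modules over a local ring have minimal free covers. -/
theorem IsLocalRing.exists_minimal_cover (M : Type v) [AddCommGroup M] [Module R M]
    [Module.Finite R M] : ∃ (r : ℕ) (φ : (Fin r →₀ R) →ₗ[R] M), Function.Surjective φ ∧
      LinearMap.ker φ ≤ IsLocalRing.maximalIdeal R • ⊤ := by
  let k := IsLocalRing.ResidueField R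
  let b := Module.finBasis k (k ⊗[R] M)
  have hsurj : Function.Surjective (TensorProduct.mk R k M 1) :=
    TensorProduct.mk_surjective R M k IsLocalRing.residue_surjective
  choose m hm using fun i => hsurj (b i)
  refine ⟨_, Finsupp.linearCombination R m, ?_, fun g hg => ?_⟩
  · rw [← LinearMap.range_eq_top, Finsupp.range_linearCombination]
    exact IsLocalRing.span_eq_top_of_tmul_eq_basis m b hm
  · refine Finsupp.mem_smul_top_of_forall_mem _ g fun i => ?_
    -- A relation among the generators reduces to one among basis vectors of `k ⊗ M`, so its
    -- coefficients lie in the maximal ideal.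
    have h0 : ∑ i, IsLocalRing.residue R (g i) • b i = 0 := by
      have h1 := congrArg (TensorProduct.mk R k M 1) (LinearMap.mem_ker.1 hg)
      rw [Finsupp.linearCombination_apply, Finsupp.sum_fintype _ _ (by simp), map_sum,
        map_zero] at h1
      rw [← h1]
      refine Finset.sum_congr rfl fun i _ => ?_
      rw [map_smul, hm]
      exact (algebraMap_smul k (g i) (b i))
    exact (IsLocalRing.residue_eq_zero_iff _).1
      (Fintype.linearIndependent_iff.1 b.linearIndependent _ h0 i)

/-- A minimal free resolution of a finitely generated module by modules `R ^ r n`, presented by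
its syzygy modules `K n`. -/
theorem IsLocalRing.exists_minimal_syzygies [IsNoetherianRing R] (M : Type v) [AddCommGroup M]
    [Module R M] [Module.Finite R M] :
    ∃ (r : ℕ → ℕ) (K : ∀ n, Submodule R (Fin (r n) →₀ R)) (ε : (Fin (r 0) →₀ R) →ₗ[R] M)
      (δ : ∀ n, (Fin (r (n + 1)) →₀ R) →ₗ[R] (Fin (r n) →₀ R)),
      Function.Surjective ε ∧ LinearMap.ker ε = K 0 ∧ (∀ n, LinearMap.range (δ n) = K n) ∧
      (∀ n, LinearMap.ker (δ n) = K (n + 1)) ∧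
      ∀ n, K n ≤ IsLocalRing.maximalIdeal R • ⊤ := by
  obtain ⟨r₀, ε, hε, hker⟩ := IsLocalRing.exists_minimal_cover (R := R) M
  -- The state of the recursion is a rank together with the syzygy module to be covered next.
  have step : ∀ st : (r : ℕ) × Submodule R (Fin r →₀ R),
      ∃ (st' : (r : ℕ) × Submodule R (Fin r →₀ R)) (δ : (Fin st'.1 →₀ R) →ₗ[R] (Fin st.1 →₀ R)),
      LinearMap.range δ = st.2 ∧ LinearMap.ker δ = st'.2 ∧
        st'.2 ≤ IsLocalRing.maximalIdeal R • ⊤ := by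
    rintro ⟨r, K⟩
    obtain ⟨r', φ, hφ, hφker⟩ := IsLocalRing.exists_minimal_cover (R := R) K
    refine ⟨⟨r', LinearMap.ker φ⟩, K.subtype ∘ₗ φ, ?_, ?_, hφker⟩
    · rw [LinearMap.range_comp, LinearMap.range_eq_top.2 hφ, Submodule.map_top,
        Submodule.range_subtype]
    · rw [LinearMap.ker_comp, Submodule.ker_subtype, LinearMap.ker]
  choose next δ hrange hkerδ hle using step
  let st : ℕ → (r : ℕ) × Submodule R (Fin r →₀ R) :=
    fun n => Nat.rec ⟨r₀, LinearMap.ker ε⟩ (fun _ s => next s) n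
  refine ⟨fun n => (st n).1, fun n => (st n).2, ε, fun n => δ (st n), hε, rfl,
    fun n => hrange (st n), fun n => hkerδ (st n), fun n => ?_⟩
  cases n with
  | zero => exact hker
  | succ n => exact hle (st n)

end LocalRing

/-! ### Construction of the differential and the augmentation on generators -/

namespace Stage

/-- The basis of the flag under construction: `r n t` elements in filtration degree `n` of the
`t`-th strand. -/
abbrev Idx {d : ℕ} (r : ℕ → ZMod d → ℕ) : Type := (n : ℕ) × (t : ZMod d) × Fin (r n t)

variable {R : Type u} [CommRing R] {d : ℕ} {r : ℕ → ZMod d → ℕ}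

/-- The `ℤ/d`-degree of a basis element. -/
def Idx.degree (s : Idx r) : ZMod d := (s.1 : ZMod d) + s.2.1

variable (R r) in
/-- The elements of degree `j` and of filtration less than `n`. -/
noncomputable def lower (n : ℕ) (j : ZMod d) : Submodule R (Idx r →₀ R) :=
  Finsupp.supported R R {s | s.1 < n ∧ s.degree = j}

variable (R r) in
/-- The inclusion of the component of filtration `n` in the `t`-th strand. -/
noncomputable def incl (n : ℕ) (t : ZMod d) : (Fin (r n t) →₀ R) →ₗ[R] (Idx r →₀ R) :=
  Finsupp.lmapDomain R R fun k => ⟨n, t, k⟩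

theorem lower_mono {n m : ℕ} (h : n ≤ m) (j : ZMod d) : lower R r n j ≤ lower R r m j :=
  Finsupp.supported_mono fun _ hs => ⟨lt_of_lt_of_le hs.1 h, hs.2⟩

theorem lower_zero (j : ZMod d) : lower R r 0 j = ⊥ := by
  rw [lower, ← Finsupp.supported_empty (M := R) (R := R)]
  congr 1
  ext s
  simp

theorem incl_mem (n : ℕ) (t : ZMod d) (g : Fin (r n t) →₀ R) :
    incl R r n t g ∈ lower R r (n + 1) (n + t) := by
  classical
  refine (Finsupp.mem_supported _ _).2 fun s hs => ?_
  obtain ⟨k, -, rfl⟩ := Finset.mem_image.1 (Finsupp.mapDomain_support hs)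
  exact ⟨Nat.lt_succ_self n, rfl⟩

theorem incl_single (n : ℕ) (t : ZMod d) (k : Fin (r n t)) (a : R) :
    incl R r n t (Finsupp.single k a) = Finsupp.single ⟨n, t, k⟩ a :=
  Finsupp.mapDomain_single

theorem idx_injective (n : ℕ) (t : ZMod d) :
    Function.Injective fun k => (⟨n, t, k⟩ : Idx r) := fun k k' h => by
  simpa using h

theorem eq_zero_of_incl_mem (n : ℕ) (t j : ZMod d) (g : Fin (r n t) →₀ R)
    (h : incl R r n t g ∈ lower R r n j) : g = 0 := by
  ext k
  have := (Finsupp.mem_supported' _ _).1 h ⟨n, t, k⟩ fun hs => lt_irrefl _ hs.1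
  rwa [incl, Finsupp.lmapDomain_apply, Finsupp.mapDomain_apply (idx_injective n t)] at this

theorem exists_incl_add (n : ℕ) (t : ZMod d) (x : Idx r →₀ R)
    (hx : x ∈ lower R r (n + 1) (n + t)) :
    ∃ g, ∃ y ∈ lower R r n (n + t), x = incl R r n t g + y := by
  refine ⟨x.comapDomain (fun k => ⟨n, t, k⟩) (idx_injective n t).injOn,
    x - incl R r n t (x.comapDomain (fun k => ⟨n, t, k⟩) (idx_injective n t).injOn), ?_,
    (add_sub_cancel _ _).symm⟩
  refine (Finsupp.mem_supported' _ _).2 fun s hs => ?_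
  rw [Finsupp.sub_apply, sub_eq_zero]
  by_cases h : s.1 = n ∧ s.2.1 = t
  · obtain ⟨m, t', k⟩ := s
    obtain ⟨rfl, rfl⟩ := h
    rw [incl, Finsupp.lmapDomain_apply, Finsupp.mapDomain_apply (idx_injective _ _)]
    rfl
  · rw [incl, Finsupp.lmapDomain_apply, Finsupp.mapDomain_of_notMem_range]
    · refine (Finsupp.mem_supported' _ _).1 hx s fun hs' => ?_
      by_cases hn : s.1 = n
      · refine h ⟨hn, ?_⟩
        have h2 : (s.1 : ZMod d) + s.2.1 = n + t := hs'.2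
        exact add_left_cancel (h2.trans (congrArg (fun m : ℕ => (m : ZMod d) + t) hn.symm))
      · exact hs ⟨lt_of_le_of_ne (Nat.lt_succ_iff.1 hs'.1) hn, hs'.2⟩
    · rintro ⟨k, rfl⟩
      exact h ⟨rfl, rfl⟩

variable {D : DiffMod.{u, v} R d}

variable (r D) in
/-- The part of degree `j` and filtration less than `n` of the cone of the augmentation. -/
noncomputable def cone (n : ℕ) (j : ZMod d) : Submodule R ((Idx r →₀ R) × D.carrier) :=
  (lower R r n j).prod (D.deg (j + 1))

/-- The differential of the cone of the augmentation, if `v` gives the values on the basis of the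
differential and of the augmentation. -/
noncomputable def coneDiff (v : Idx r → (Idx r →₀ R) × D.carrier) :
    ((Idx r →₀ R) × D.carrier) →ₗ[R] ((Idx r →₀ R) × D.carrier) :=
  Finsupp.linearCombination R v ∘ₗ LinearMap.fst R _ _ -
    LinearMap.inr R _ _ ∘ₗ D.diff ∘ₗ LinearMap.snd R _ _

theorem coneDiff_apply (v : Idx r → (Idx r →₀ R) × D.carrier) (x : Idx r →₀ R) (η : D.carrier) :
    coneDiff v (x, η) = Finsupp.linearCombination R v x - (0, D.diff η) := rfl

theorem cone_mono {n m : ℕ} (h : n ≤ m) (j : ZMod d) : cone r D n j ≤ cone r D m j :=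
  Submodule.prod_mono (lower_mono h j) le_rfl

theorem inl_incl_mem (n : ℕ) (t : ZMod d) (g : Fin (r n t) →₀ R) :
    (incl R r n t g, (0 : D.carrier)) ∈ cone r D (n + 1) (n + t) :=
  ⟨incl_mem n t g, Submodule.zero_mem _⟩

theorem coneDiff_congr {v v' : Idx r → (Idx r →₀ R) × D.carrier} {n : ℕ}
    (h : ∀ s, s.1 < n → v s = v' s) {j : ZMod d} {c : (Idx r →₀ R) × D.carrier}
    (hc : c ∈ cone r D n j) : coneDiff v c = coneDiff v' c := by
  obtain ⟨x, η⟩ := c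
  rw [coneDiff_apply, coneDiff_apply, Finsupp.linearCombination_apply,
    Finsupp.linearCombination_apply]
  congr 1
  refine Finsupp.sum_congr fun s hs => ?_
  rw [h s ((Finsupp.mem_supported _ _).1 hc.1 hs).1]

theorem coneDiff_mem {v : Idx r → (Idx r →₀ R) × D.carrier} {n : ℕ}
    (h : ∀ s, s.1 < n → v s ∈ cone r D s.1 (s.degree - 1)) {j : ZMod d}
    {c : (Idx r →₀ R) × D.carrier} (hc : c ∈ cone r D n j) :
    coneDiff v c ∈ cone r D n (j - 1) := by
  obtain ⟨x, η⟩ := c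
  rw [coneDiff_apply, Finsupp.linearCombination_apply]
  refine Submodule.sub_mem _ (Submodule.sum_mem _ fun s hs => Submodule.smul_mem _ _ ?_)
    ⟨Submodule.zero_mem _, ?_⟩
  · obtain ⟨h1, rfl⟩ := (Finsupp.mem_supported _ _).1 hc.1 hs
    exact cone_mono h1.le _ (h s h1)
  · have := D.diff_mem_deg _ _ hc.2
    rwa [add_sub_right_comm] at this

theorem exists_incl_add_cone (n : ℕ) (t : ZMod d) (e : (Idx r →₀ R) × D.carrier)
    (he : e ∈ cone r D (n + 1) (n + t)) :
    ∃ g, ∃ c ∈ cone r D n (n + t), e = (incl R r n t g, 0) + c := by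
  obtain ⟨x, η⟩ := e
  obtain ⟨g, y, hy, rfl⟩ := exists_incl_add n t x he.1
  exact ⟨g, (y, η), ⟨hy, he.2⟩, by simp⟩

/-- The map `l` identifies the homology of the `n`-th stage of the cone with `R ^ r n t / K`. -/
structure IsPresentation (v : Idx r → (Idx r →₀ R) × D.carrier) (n : ℕ) (t : ZMod d)
    (K : Submodule R (Fin (r n t) →₀ R))
    (l : (Fin (r n t) →₀ R) →ₗ[R] (Idx r →₀ R) × D.carrier) : Prop where
  mem : ∀ g, l g ∈ cone r D n (n + t - 1)
  cycle : ∀ g, coneDiff v (l g) = 0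
  exists_eq : ∀ c ∈ cone r D n (n + t - 1), coneDiff v c = 0 →
    ∃ g, ∃ b ∈ cone r D n (n + t), coneDiff v b = c - l g
  boundary_iff : ∀ g, (∃ b ∈ cone r D n (n + t), coneDiff v b = l g) ↔ g ∈ K

/-- The differential and the augmentation are defined on the first `n` steps of the filtration. -/
structure IsStage (K : ∀ n t, Submodule R (Fin (r n t) →₀ R))
    (v : Idx r → (Idx r →₀ R) × D.carrier) (n : ℕ) : Prop where
  mem : ∀ s, s.1 < n → v s ∈ cone r D s.1 (s.degree - 1)
  cycle : ∀ s, s.1 < n → coneDiff v (v s) = 0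
  presentation : ∀ t, ∃ l, IsPresentation v n t (K n t) l

/-- Before any generator is attached the cone is a shift of `D`, with homology `H_t(D)` in degree `t
- 1`; `l` lifts `ε` to cycles. -/
theorem exists_isPresentation_zero (v : Idx r → (Idx r →₀ R) × D.carrier) (t : ZMod d)
    (ε : (Fin (r 0 t) →₀ R) →ₗ[R] D.homology t) (hε : Function.Surjective ε) :
    ∃ l, IsPresentation v 0 t (LinearMap.ker ε) l := by
  obtain ⟨l, hl⟩ := Module.projective_lifting_property
    ((D.boundaries t).submoduleOf (D.cycles t)).mkQ ε (Submodule.mkQ_surjective _)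
  have hl' : ∀ g, (Submodule.Quotient.mk (l g) : D.homology t) = ε g :=
    fun g => LinearMap.congr_fun hl g
  have e0 : ((0 : ℕ) : ZMod d) + t - 1 + 1 = t := by simp
  have e1 : ((0 : ℕ) : ZMod d) + t + 1 = t + 1 := by simp
  have hd : ∀ η : D.carrier, coneDiff v (0, η) = (0, - D.diff η) := fun η => by
    simp [coneDiff_apply]
  have hmem : ∀ (j : ZMod d) (c : (Idx r →₀ R) × D.carrier), c ∈ cone r D 0 j ↔
      c.1 = 0 ∧ c.2 ∈ D.deg (j + 1) := fun j c => by
    rw [cone, lower_zero]; rfl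
  refine ⟨LinearMap.inr R _ _ ∘ₗ (D.cycles t).subtype ∘ₗ l, ?_, ?_, ?_, ?_⟩
  · intro g
    rw [hmem, e0]
    exact ⟨rfl, (l g).2.2⟩
  · intro g
    refine (hd _).trans ?_
    have : D.diff (l g) = 0 := (l g).2.1
    simp [this]
  · rintro ⟨x, η⟩ hc hdc
    obtain ⟨rfl, hη⟩ := (hmem _ _).1 hc
    rw [e0] at hη
    have hdη : D.diff η = 0 := neg_eq_zero.1 (congrArg Prod.snd ((hd η).symm.trans hdc))
    obtain ⟨g, hg⟩ := hε (Submodule.Quotient.mk ⟨η, hdη, hη⟩)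
    rw [← hl'] at hg
    obtain ⟨k, hk, hkη⟩ :=
      (Submodule.Quotient.eq ((D.boundaries t).submoduleOf (D.cycles t))).1 hg
    refine ⟨g, (0, k), (hmem _ _).2 ⟨rfl, e1.symm ▸ hk⟩, ?_⟩
    have hkη' : D.diff k = l g - η := hkη
    rw [hd, hkη']
    simp
  · intro g
    rw [LinearMap.mem_ker, ← hl', Submodule.Quotient.mk_eq_zero]
    constructor
    · rintro ⟨⟨x, k⟩, hb, hbg⟩
      obtain ⟨rfl, hk⟩ := (hmem _ _).1 hb
      rw [e1] at hk
      refine ⟨-k, Submodule.neg_mem _ hk, ?_⟩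
      rw [hd] at hbg
      rw [map_neg]
      exact congrArg Prod.snd hbg
    · rintro ⟨k, hk, hkg⟩
      refine ⟨(0, -k), (hmem _ _).2 ⟨rfl, e1.symm ▸ Submodule.neg_mem _ hk⟩, ?_⟩
      rw [hd, map_neg, neg_neg, hkg]
      rfl

section Step

variable {K : ∀ n t, Submodule R (Fin (r n t) →₀ R)}
  {v v' : Idx r → (Idx r →₀ R) × D.carrier} {n : ℕ}
  {l : ∀ t, (Fin (r n t) →₀ R) →ₗ[R] (Idx r →₀ R) × D.carrier}

theorem linearCombination_incl (hl : ∀ t k, v' ⟨n, t, k⟩ = l t (Finsupp.single k 1)) (t : ZMod d)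
    (g : Fin (r n t) →₀ R) : Finsupp.linearCombination R v' (incl R r n t g) = l t g := by
  have : Finsupp.linearCombination R v' ∘ₗ incl R r n t = l t := by
    ext1 k
    ext1
    simp [incl_single, hl]
  exact LinearMap.congr_fun this g

theorem coneDiff_incl_add (hv : ∀ s, s.1 < n → v s = v' s)
    (hl : ∀ t k, v' ⟨n, t, k⟩ = l t (Finsupp.single k 1)) (t : ZMod d) (g : Fin (r n t) →₀ R)
    {j : ZMod d} {c : (Idx r →₀ R) × D.carrier} (hc : c ∈ cone r D n j) :
    coneDiff v' ((incl R r n t g, 0) + c) = l t g + coneDiff v c := by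
  rw [map_add, coneDiff_congr hv hc, coneDiff_apply, linearCombination_incl hl]
  simp

/-- The new generators have boundaries `l t (single k 1)`, which represent generators of the
homology of the previous stage. -/
theorem exists_boundary (hv : ∀ s, s.1 < n → v s = v' s)
    (hl : ∀ t k, v' ⟨n, t, k⟩ = l t (Finsupp.single k 1))
    (hp : ∀ t, IsPresentation v n t (K n t) (l t)) (j : ZMod d)
    (c : (Idx r →₀ R) × D.carrier) (hc : c ∈ cone r D n j) (hdc : coneDiff v' c = 0) :
    ∃ b ∈ cone r D (n + 1) (j + 1), coneDiff v' b = c := by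
  obtain ⟨t, rfl⟩ : ∃ t, j = (n : ZMod d) + t - 1 := ⟨j + 1 - n, by ring⟩
  rw [sub_add_cancel]
  rw [← coneDiff_congr hv hc] at hdc
  obtain ⟨g, b, hb, hbc⟩ := (hp t).exists_eq c hc hdc
  refine ⟨(incl R r n t g, 0) + b, Submodule.add_mem _ (inl_incl_mem n t g)
    (cone_mono n.le_succ _ hb), ?_⟩
  rw [coneDiff_incl_add hv hl t g hb, hbc, add_sub_cancel]

/-- If `incl g + c` is a cycle, then `l g` is the boundary of `-c`, which is the condition for `g`
to be a syzygy. -/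
theorem cycle_mem (hv : ∀ s, s.1 < n → v s = v' s)
    (hl : ∀ t k, v' ⟨n, t, k⟩ = l t (Finsupp.single k 1))
    (hp : ∀ t, IsPresentation v n t (K n t) (l t)) (t : ZMod d)
    (e : (Idx r →₀ R) × D.carrier) (he : e ∈ cone r D (n + 1) (n + t))
    (hde : coneDiff v' e = 0) :
    ∃ g ∈ K n t, ∃ c ∈ cone r D n (n + t), e = (incl R r n t g, 0) + c := by
  obtain ⟨g, c, hc, rfl⟩ := exists_incl_add_cone n t e he
  refine ⟨g, ((hp t).boundary_iff g).1 ⟨-c, Submodule.neg_mem _ hc, ?_⟩, c, hc, rfl⟩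
  rw [coneDiff_incl_add hv hl t g hc] at hde
  rw [map_neg]
  exact (eq_neg_of_add_eq_zero_left hde).symm

/-- The source of minimality of the anchor: leading coefficients of cycles are syzygies, and these
lie in `I • ⊤`. -/
theorem cycle_fst_mem (I : Ideal R) (hK : ∀ n t, K n t ≤ I • ⊤)
    (hv : ∀ s, s.1 < n → v s = v' s)
    (hl : ∀ t k, v' ⟨n, t, k⟩ = l t (Finsupp.single k 1))
    (hp : ∀ t, IsPresentation v n t (K n t) (l t)) (j : ZMod d)
    (e : (Idx r →₀ R) × D.carrier) (he : e ∈ cone r D (n + 1) j) (hde : coneDiff v' e = 0) :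
    e.1 ∈ I • lower R r (n + 1) j ⊔ lower R r n j := by
  obtain ⟨t, rfl⟩ : ∃ t, j = (n : ZMod d) + t := ⟨j - n, by ring⟩
  obtain ⟨g, hg, c, hc, rfl⟩ := cycle_mem hv hl hp t e he hde
  refine Submodule.add_mem_sup ?_ hc.1
  have h1 := Submodule.mem_map_of_mem (f := incl R r n t) (hK n t hg)
  rw [Submodule.map_smul''] at h1
  refine Submodule.smul_mono le_rfl ?_ h1
  rintro _ ⟨x, -, rfl⟩
  exact incl_mem n t x

/-- The leading coefficient identifies the new homology with `K n t`: leading coefficients of cycles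
lie there, a cycle without one bounds by `exists_boundary`, and boundaries have none because `∂`
lowers the filtration. As `δ t` maps onto `K n t` with kernel `K (n + 1) t`, this is the next
presentation. -/
theorem IsStage.succ (hs : IsStage K v n) (hv : ∀ s, s.1 < n → v s = v' s)
    (hl : ∀ t k, v' ⟨n, t, k⟩ = l t (Finsupp.single k 1))
    (hp : ∀ t, IsPresentation v n t (K n t) (l t))
    (δ : ∀ t, (Fin (r (n + 1) t) →₀ R) →ₗ[R] (Fin (r n t) →₀ R))
    (hrange : ∀ t, LinearMap.range (δ t) = K n t)
    (hker : ∀ t, LinearMap.ker (δ t) = K (n + 1) t) : IsStage K v' (n + 1) := by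
  have hmem : ∀ s, s.1 < n + 1 → v' s ∈ cone r D s.1 (s.degree - 1) ∧ coneDiff v' (v' s) = 0 := by
    intro s hsn
    rcases Nat.lt_succ_iff_lt_or_eq.1 hsn with h | h
    · rw [← hv s h]
      have h1 := hs.mem s h
      exact ⟨h1, (coneDiff_congr hv (cone_mono h.le _ h1)).symm.trans (hs.cycle s h)⟩
    · obtain ⟨m, t, k⟩ := s
      obtain rfl : m = n := h
      rw [hl]
      have h1 := (hp t).mem (Finsupp.single k 1)
      exact ⟨h1, (coneDiff_congr hv h1).symm.trans ((hp t).cycle _)⟩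
  refine ⟨fun s h => (hmem s h).1, fun s h => (hmem s h).2, fun t => ?_⟩
  have e1 : ((n + 1 : ℕ) : ZMod d) + t - 1 = n + t := by push_cast; ring
  have e2 : ((n + 1 : ℕ) : ZMod d) + t = n + t + 1 := by push_cast; ring
  have hδ : ∀ g, δ t g ∈ K n t := fun g => hrange t ▸ LinearMap.mem_range_self _ g
  choose b hb hbl using fun k : Fin (r (n + 1) t) =>
    ((hp t).boundary_iff _).2 (hδ (Finsupp.single k 1))
  let β : (Fin (r (n + 1) t) →₀ R) →ₗ[R] (Idx r →₀ R) × D.carrier :=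
    Finsupp.linearCombination R b
  have hβ : ∀ g, β g ∈ cone r D n (n + t) := by
    intro g
    change Finsupp.linearCombination R b g ∈ _
    rw [Finsupp.linearCombination_apply]
    exact Submodule.sum_mem _ fun k _ => Submodule.smul_mem _ _ (hb k)
  have hβl : ∀ g, coneDiff v (β g) = l t (δ t g) := by
    have : coneDiff v ∘ₗ β = l t ∘ₗ δ t := by
      ext1 k
      ext1
      simp [β, hbl]
    exact fun g => LinearMap.congr_fun this g
  -- A cycle with leading coefficient `δ t g`: the boundary `l t (δ t g)` of that term is cancelled
  -- by `β g`.
  let l' : (Fin (r (n + 1) t) →₀ R) →ₗ[R] (Idx r →₀ R) × D.carrier :=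
    LinearMap.inl R _ _ ∘ₗ incl R r n t ∘ₗ δ t - β
  have hl' : ∀ g, l' g = (incl R r n t (δ t g), 0) + (- β g) := fun g => sub_eq_add_neg _ _
  have hmem' : ∀ g, l' g ∈ cone r D (n + 1) (n + t) := fun g => by
    rw [hl']
    exact Submodule.add_mem _ (inl_incl_mem n t _)
      (Submodule.neg_mem _ (cone_mono n.le_succ _ (hβ g)))
  have hcyc' : ∀ g, coneDiff v' (l' g) = 0 := fun g => by
    rw [hl', coneDiff_incl_add hv hl t _ (Submodule.neg_mem _ (hβ g)), map_neg, hβl,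
      add_neg_cancel]
  refine ⟨l', fun g => e1 ▸ hmem' g, hcyc', ?_, ?_⟩
  · rw [e1, e2]
    intro c hc hdc
    obtain ⟨x, hx, c', hc', rfl⟩ := cycle_mem hv hl hp t c hc hdc
    obtain ⟨g, rfl⟩ : x ∈ LinearMap.range (δ t) := hrange t ▸ hx
    have heq : (incl R r n t (δ t g), 0) + c' - l' g = c' + β g := by
      rw [hl']; abel
    obtain ⟨b', hb', hbc⟩ := exists_boundary hv hl hp (n + t) (c' + β g)
      (Submodule.add_mem _ hc' (hβ g)) (by rw [← heq, map_sub, hdc, hcyc', sub_zero])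
    exact ⟨g, b', hb', by rw [hbc, heq]⟩
  · intro g
    rw [e2, ← hker, LinearMap.mem_ker]
    constructor
    · rintro ⟨b', hb', hbg⟩
      -- In degree `n + t + 1` the generators of filtration `n` belong to the strand `t + 1`.
      rw [add_assoc] at hb'
      obtain ⟨x, c, hc, rfl⟩ := exists_incl_add_cone n (t + 1) b' hb'
      rw [coneDiff_incl_add hv hl _ x hc, hl'] at hbg
      have h1 := Submodule.add_mem _ ((hp (t + 1)).mem x) (coneDiff_mem hs.mem hc)
      rw [hbg, ← add_assoc, add_sub_cancel_right] at h1
      have h2 := Submodule.add_mem _ h1 (hβ g)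
      rw [neg_add_cancel_right] at h2
      exact eq_zero_of_incl_mem n t _ _ h2.1
    · intro h0
      have heq : l' g = - β g := by rw [hl', h0, map_zero]; simp
      have hc := Submodule.neg_mem _ (hβ g)
      rw [← heq] at hc
      exact exists_boundary hv hl hp (n + t) (l' g) hc (hcyc' g)

end Step

theorem exists_coneDiff {K : ∀ n t, Submodule R (Fin (r n t) →₀ R)} (I : Ideal R)
    (hK : ∀ n t, K n t ≤ I • ⊤) (ε : ∀ t, (Fin (r 0 t) →₀ R) →ₗ[R] D.homology t)
    (hε : ∀ t, Function.Surjective (ε t)) (hεK : ∀ t, LinearMap.ker (ε t) = K 0 t)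
    (δ : ∀ n t, (Fin (r (n + 1) t) →₀ R) →ₗ[R] (Fin (r n t) →₀ R))
    (hrange : ∀ n t, LinearMap.range (δ n t) = K n t)
    (hker : ∀ n t, LinearMap.ker (δ n t) = K (n + 1) t) :
    ∃ v : Idx r → (Idx r →₀ R) × D.carrier,
      (∀ s, v s ∈ cone r D s.1 (s.degree - 1)) ∧ (∀ s, coneDiff v (v s) = 0) ∧
      (∀ n j, ∀ c ∈ cone r D n j, coneDiff v c = 0 →
        ∃ b ∈ cone r D (n + 1) (j + 1), coneDiff v b = c) ∧
      ∀ n j, ∀ e ∈ cone r D (n + 1) j, coneDiff v e = 0 →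
        e.1 ∈ I • lower R r (n + 1) j ⊔ lower R r n j := by
  classical
  -- The default `0` makes `L` total, so `V` is defined by plain recursion before its terms are
  -- known to be stages.
  have hpres : ∀ (v : Idx r → (Idx r →₀ R) × D.carrier) n t, ∃ l, IsStage K v n →
      IsPresentation v n t (K n t) l := by
    intro v n t
    by_cases h : IsStage K v n
    · obtain ⟨l, hl⟩ := h.presentation t
      exact ⟨l, fun _ => hl⟩
    · exact ⟨0, fun h' => absurd h' h⟩
  choose L hL using hpres
  let V : ℕ → Idx r → (Idx r →₀ R) × D.carrier := fun n => Nat.rec 0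
    (fun n v s => if s.1 < n then v s else L v s.1 s.2.1 (Finsupp.single s.2.2 1)) n
  have hVlt : ∀ n s, s.1 < n → V n s = V (n + 1) s := fun n s h => (if_pos h).symm
  have hVeq : ∀ n t k, V (n + 1) ⟨n, t, k⟩ = L (V n) n t (Finsupp.single k 1) :=
    fun n t k => if_neg (lt_irrefl n)
  have hstage : ∀ n, IsStage K (V n) n := by
    intro n
    induction n with
    | zero =>
      refine ⟨fun s hs => absurd hs (Nat.not_lt_zero _), fun s hs => absurd hs (Nat.not_lt_zero _),
        fun t => ?_⟩
      rw [← hεK]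
      exact exists_isPresentation_zero _ t (ε t) (hε t)
    | succ n ih =>
      exact ih.succ (hVlt n) (hVeq n) (fun t => hL _ _ t ih) (δ n) (hrange n) (hker n)
  -- The value at a generator of filtration `n` is final from `V (n + 1)` on.
  let v : Idx r → (Idx r →₀ R) × D.carrier := fun s => V (s.1 + 1) s
  have hvV : ∀ n s, s.1 < n → V n s = v s := by
    intro n s h
    induction n with
    | zero => omega
    | succ n ih =>
      rcases Nat.lt_succ_iff_lt_or_eq.1 h with h' | h'
      · rw [← hVlt n s h', ih h']
      · subst h'; rfl
  have hmem : ∀ s, v s ∈ cone r D s.1 (s.degree - 1) :=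
    fun s => (hstage (s.1 + 1)).mem s (Nat.lt_succ_self _)
  refine ⟨v, hmem, fun s => ?_, fun n j c hc hdc => ?_, fun n j e he hde => ?_⟩
  · rw [← coneDiff_congr (hvV s.1) (hmem s), coneDiff_congr (hVlt s.1) (hmem s)]
    exact (hstage (s.1 + 1)).cycle s (Nat.lt_succ_self _)
  · rw [← coneDiff_congr (hvV (n + 1)) (cone_mono n.le_succ j hc)] at hdc
    obtain ⟨b, hb, hbc⟩ := exists_boundary (hVlt n) (hVeq n)
      (fun t => hL _ _ t (hstage n)) j c hc hdc
    exact ⟨b, hb, by rw [← coneDiff_congr (hvV (n + 1)) hb, hbc]⟩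
  · rw [← coneDiff_congr (hvV (n + 1)) he] at hde
    exact cycle_fst_mem I hK (hVlt n) (hVeq n) (fun t => hL _ _ t (hstage n)) j e he hde

end Stage

/-! ### From acyclicity of the cone back to anchored resolutions -/

namespace DiffFlag

variable {R : Type u} [CommRing R] {d : ℕ} {F : DiffFlag.{u, v} R d} {D : DiffMod.{u, w} R d}
  {a : DiffMod.Hom F.toDiffMod D}

theorem ConeAcyclic.exists_diff_eq (h : F.ConeAcyclic a) (i : ℕ) (j : ZMod d) (x : F.carrier)
    (hx : x ∈ F.fil i j) (hdx : F.diff x = 0) (k : D.carrier) (hk : k ∈ D.deg (j + 1))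
    (hkx : D.diff k = a.toLin x) : ∃ y ∈ F.fil (i + 1) (j + 1), F.diff y = x := by
  obtain ⟨y, hy, -, -, hyx, -⟩ := h (i + 1) j x hx k hk hdx hkx
  exact ⟨y, hy, hyx⟩

/-- The cycle `(0, z)` of the cone has filtration `-1`, so it is the boundary of an element of
filtration `0`. -/
theorem ConeAcyclic.exists_aug_sub_mem (h : F.ConeAcyclic a) (j : ZMod d) (z : D.carrier)
    (hz : z ∈ D.deg j) (hdz : D.diff z = 0) :
    ∃ y ∈ F.fil 0 j, ∃ k ∈ D.deg (j + 1), D.diff k = a.toLin y - z := by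
  obtain ⟨y, hy, k, hk, -, hky⟩ := h 0 (j - 1) 0 (Submodule.zero_mem _) z
    (by rwa [sub_add_cancel]) (map_zero _) (by rw [hdz, map_zero])
  rw [sub_add_cancel] at hy hk
  exact ⟨y, hy, k, hk, hky⟩

theorem ConeAcyclic.isQuasiIso (h : F.ConeAcyclic a) : a.IsQuasiIso := by
  refine a.isQuasiIso_iff.2 ⟨fun j x hx hdx k hk hkx => ?_, fun j z hz hdz => ?_⟩
  · obtain ⟨i, hi⟩ := F.fil_exhaustive j x hx
    obtain ⟨y, hy, hyx⟩ := h.exists_diff_eq i j x hi hdx k hk hkx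
    exact ⟨y, F.fil_le_deg _ _ hy, hyx⟩
  · obtain ⟨y, hy, k, hk, hky⟩ := h.exists_aug_sub_mem j z hz hdz
    exact ⟨y, F.fil_le_deg _ _ hy, F.diff_fil_zero j y hy, k, hk, hky⟩

/-- The cycle `(∂x, a x)` is the boundary of some `(y, k)` with `y` in filtration `n`. Then `x - y`
is a cycle whose image in `D` bounds, hence `x - y = ∂w` with `w` in filtration `n + 2`. -/
theorem ConeAcyclic.anchorExact (h : F.ConeAcyclic a) : F.AnchorExact := by
  intro n j x hx hdx
  obtain ⟨y, hy, k, hk, hyx, hky⟩ := h n (j - 1) _ hdx (a.toLin x)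
    (by rw [sub_add_cancel]; exact a.mem_deg _ _ (F.fil_le_deg _ _ hx)) (F.diff_diff x)
    (a.comm x)
  rw [sub_add_cancel] at hy hk
  obtain ⟨w, hw, hwx⟩ := h.exists_diff_eq (n + 1) j (x - y)
    (Submodule.sub_mem _ hx (F.fil_mono _ _ hy)) (by rw [map_sub, hyx, sub_self]) (-k)
    (Submodule.neg_mem _ hk) (by rw [map_neg, hky, map_sub, neg_sub])
  exact ⟨w, hw, by rwa [hwx, sub_sub_cancel]⟩

theorem AnchorExact.exact (h : F.AnchorExact) (t : ZMod d) (n : ℕ) :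
    Function.Exact (F.anchorDiff t (n + 1)) (F.anchorDiff t n) := by
  intro x
  obtain ⟨⟨x, hx⟩, rfl⟩ := Submodule.Quotient.mk_surjective _ x
  have e : ((n + 1 : ℕ) : ZMod d) + t - 1 = (n : ZMod d) + t := by push_cast; ring
  have e' : ((n + 1 : ℕ) : ZMod d) + t + 1 = ((n + 2 : ℕ) : ZMod d) + t := by push_cast; ring
  constructor
  · intro h0
    have hdx : F.diff x ∈ F.filBelow n ((n : ZMod d) + t) :=
      (Submodule.Quotient.mk_eq_zero
        ((F.filBelow n ((n : ZMod d) + t)).submoduleOf (F.fil n ((n : ZMod d) + t)))).1 h0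
    rw [← e] at hdx
    obtain ⟨y, hy, hyx⟩ := h n _ x hx hdx
    rw [e'] at hy
    refine ⟨Submodule.Quotient.mk ⟨y, hy⟩, Eq.symm ?_⟩
    exact (Submodule.Quotient.eq
      ((F.filBelow (n + 1) (((n + 1 : ℕ) : ZMod d) + t)).submoduleOf (F.fil (n + 1) _))).2 hyx
  · rintro ⟨y, hy⟩
    obtain ⟨⟨y, hy'⟩, rfl⟩ := Submodule.Quotient.mk_surjective _ y
    rw [← hy]
    refine (Submodule.Quotient.mk_eq_zero _).2 ?_
    change F.diff (F.diff y) ∈ F.filBelow n ((n : ZMod d) + t)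
    rw [F.diff_diff]
    exact Submodule.zero_mem _

theorem aug_mem_cycles (a : DiffMod.Hom F.toDiffMod D) (t : ZMod d) :
    ∀ x ∈ F.fil 0 (((0 : ℕ) : ZMod d) + t), a.toLin x ∈ D.cycles t := by
  intro x hx
  have e : ((0 : ℕ) : ZMod d) + t = t := by simp
  rw [e] at hx
  exact a.map_cycles t x ⟨F.diff_fil_zero _ x hx, F.fil_le_deg _ _ hx⟩

/-- The augmentation of the `t`-th strand of the anchor. -/
def anchorAug (a : DiffMod.Hom F.toDiffMod D) (t : ZMod d) : F.anchor t 0 →ₗ[R] D.homology t :=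
  Submodule.mapQ _ _ (a.toLin.restrict (aug_mem_cycles a t)) fun x hx => by
    have h0 : (x : F.carrier) = 0 := hx
    change a.toLin x ∈ D.boundaries t
    rw [h0, map_zero]
    exact Submodule.zero_mem _

theorem ConeAcyclic.isProjectiveResolution (h : F.ConeAcyclic a) (hF : F.IsProjective)
    (t : ZMod d) : IsProjectiveResolution (F.anchor t) (F.anchorDiff t) (anchorAug a t) where
  projective n := hF n _
  exact_succ := h.anchorExact.exact t
  exact_zero x := by
    obtain ⟨⟨x, hx⟩, rfl⟩ := Submodule.Quotient.mk_surjective _ x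
    have e : ((0 : ℕ) : ZMod d) + t + 1 = t + 1 := by simp
    have e' : ((0 : ℕ) : ZMod d) + t + 1 = ((0 + 1 : ℕ) : ZMod d) + t := by push_cast; ring
    constructor
    · intro h0
      obtain ⟨k, hk, hkx⟩ : a.toLin x ∈ D.boundaries t :=
        (Submodule.Quotient.mk_eq_zero ((D.boundaries t).submoduleOf (D.cycles t))).1 h0
      obtain ⟨y, hy, hyx⟩ := h.exists_diff_eq 0 _ x hx (F.diff_fil_zero _ x hx) k (e ▸ hk) hkx
      rw [e'] at hy
      exact ⟨Submodule.Quotient.mk ⟨y, hy⟩, congrArg Submodule.Quotient.mk (Subtype.ext hyx)⟩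
    · rintro ⟨y, hy⟩
      obtain ⟨⟨y, hy'⟩, rfl⟩ := Submodule.Quotient.mk_surjective _ y
      rw [← hy]
      refine (Submodule.Quotient.mk_eq_zero _).2 ⟨a.toLin y, ?_, a.comm y⟩
      rw [← e', e] at hy'
      exact a.mem_deg _ _ (F.fil_le_deg _ _ hy')
  surjective z := by
    obtain ⟨⟨z, hz1, hz2⟩, rfl⟩ := Submodule.Quotient.mk_surjective _ z
    obtain ⟨y, hy, k, hk, hky⟩ := h.exists_aug_sub_mem t z hz2 hz1
    have e : ((0 : ℕ) : ZMod d) + t = t := by simp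
    rw [← e] at hy
    refine ⟨Submodule.Quotient.mk ⟨y, hy⟩, ?_⟩
    exact (Submodule.Quotient.eq ((D.boundaries t).submoduleOf (D.cycles t))).2 ⟨k, hk, hky⟩

end DiffFlag

/-! ### The flag defined by the construction -/

namespace Stage

variable {R : Type u} [CommRing R] {d : ℕ} {r : ℕ → ZMod d → ℕ} {D : DiffMod.{u, v} R d}

theorem isInternal_supported_degree :
    DirectSum.IsInternal fun j : ZMod d =>
      Finsupp.supported R R {s : Idx r | s.degree = j} := by
  classical
  rw [DirectSum.isInternal_submodule_iff_iSupIndep_and_iSup_eq_top]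
  constructor
  · rw [iSupIndep_def]
    intro j
    have hle : ⨆ (i) (_ : i ≠ j), Finsupp.supported R R {s : Idx r | s.degree = i} ≤
        Finsupp.supported R R {s : Idx r | s.degree ≠ j} :=
      iSup₂_le fun i hi => Finsupp.supported_mono fun s (hs : s.degree = i) h =>
        hi (hs.symm.trans h)
    refine Disjoint.mono_right hle (Finsupp.disjoint_supported_supported ?_)
    exact Set.disjoint_left.2 fun s h1 h2 => h2 h1
  · rw [← Finsupp.supported_iUnion, ← Finsupp.supported_univ]
    congr 1
    exact Set.eq_univ_of_forall fun s => Set.mem_iUnion.2 ⟨s.degree, rfl⟩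

theorem map_supported_le {C : Type w} [AddCommGroup C] [Module R C] (f : (Idx r →₀ R) →ₗ[R] C)
    (S : Submodule R C) (T : Set (Idx r)) (h : ∀ s ∈ T, f (Finsupp.single s 1) ∈ S) :
    ∀ x ∈ Finsupp.supported R R T, f x ∈ S := by
  have hle : Finsupp.supported R R T ≤ S.comap f := by
    rw [Finsupp.supported_eq_span_single, Submodule.span_le]
    rintro _ ⟨s, hs, rfl⟩
    exact h s hs
  exact hle

theorem lower_le_deg (n : ℕ) (j : ZMod d) :
    lower R r n j ≤ Finsupp.supported R R {s : Idx r | s.degree = j} :=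
  Finsupp.supported_mono fun _ hs => hs.2

variable (R r) in
-- Restricting coordinates to filtration exactly `i` identifies the graded piece with a free module.
theorem exists_lower_surjective (i : ℕ) (j : ZMod d) :
    ∃ f : lower R r (i + 1) j →ₗ[R] ({s : Idx r | s.1 = i ∧ s.degree = j} →₀ R),
      Function.Surjective f ∧ ∀ x, f x = 0 ↔ (x : Idx r →₀ R) ∈ lower R r i j := by
  classical
  refine ⟨Finsupp.lsubtypeDomain _ ∘ₗ (lower R r (i + 1) j).subtype, fun y => ?_, ?_⟩
  · refine ⟨⟨Finsupp.mapDomain Subtype.val y, (Finsupp.mem_supported _ _).2 fun s hs => ?_⟩, ?_⟩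
    · obtain ⟨⟨s, h⟩, -, rfl⟩ := Finset.mem_image.1 (Finsupp.mapDomain_support hs)
      exact ⟨Nat.lt_succ_of_le h.1.le, h.2⟩
    · ext s
      exact Finsupp.mapDomain_apply Subtype.val_injective y s
  · rintro ⟨x, hx⟩
    refine Iff.trans ?_ (Finsupp.mem_supported' _ _).symm
    constructor
    · intro h s hs
      by_cases hsT : s.1 = i ∧ s.degree = j
      · exact DFunLike.congr_fun h (⟨s, hsT⟩ : {s : Idx r | s.1 = i ∧ s.degree = j})
      · refine (Finsupp.mem_supported' _ _).1 hx s fun hs' => ?_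
        rcases Nat.lt_succ_iff_lt_or_eq.1 hs'.1 with hlt | heq
        · exact hs ⟨hlt, hs'.2⟩
        · exact hsT ⟨heq, hs'.2⟩
    · intro h
      ext s
      exact h s fun hs' => hs'.1.ne s.2.1

theorem coneDiff_linearCombination {v : Idx r → (Idx r →₀ R) × D.carrier}
    (hcyc : ∀ s, coneDiff v (v s) = 0) (x : Idx r →₀ R) :
    coneDiff v (Finsupp.linearCombination R v x) = 0 := by
  have : coneDiff v ∘ₗ Finsupp.linearCombination R v = 0 := by
    ext1 s
    ext1
    simp [hcyc]
  exact LinearMap.congr_fun this x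

/-- The first component is `∂² = 0`, the second the compatibility of the augmentation with the
differentials. -/
theorem linearCombination_comm {v : Idx r → (Idx r →₀ R) × D.carrier}
    (hcyc : ∀ s, coneDiff v (v s) = 0) (x : Idx r →₀ R) :
    Finsupp.linearCombination R v (Finsupp.linearCombination R v x).1 =
      (0, D.diff (Finsupp.linearCombination R v x).2) :=
  sub_eq_zero.1 (coneDiff_linearCombination hcyc x)

theorem linearCombination_snd_mem {v : Idx r → (Idx r →₀ R) × D.carrier}
    (hmem : ∀ s, v s ∈ cone r D s.1 (s.degree - 1)) (j : ZMod d) :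
    ∀ x ∈ Finsupp.supported R R {s : Idx r | s.degree = j},
      (Finsupp.linearCombination R v x).2 ∈ D.deg j :=
  map_supported_le (LinearMap.snd R _ _ ∘ₗ Finsupp.linearCombination R v) _ _
    fun s (hs : s.degree = j) => by
      subst hs
      simpa using (hmem s).2

/-- The flag with basis `Idx r` whose differential is given by `v`. -/
noncomputable def flag (v : Idx r → (Idx r →₀ R) × D.carrier)
    (hmem : ∀ s, v s ∈ cone r D s.1 (s.degree - 1)) (hcyc : ∀ s, coneDiff v (v s) = 0) :
    DiffFlag.{u, u} R d where
  carrier := Idx r →₀ R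
  deg j := Finsupp.supported R R {s | s.degree = j}
  isInternal := isInternal_supported_degree
  diff := LinearMap.fst R _ _ ∘ₗ Finsupp.linearCombination R v
  diff_diff x := congrArg Prod.fst (linearCombination_comm hcyc x)
  diff_mem_deg j := map_supported_le _ _ _ fun s (hs : s.degree = j) => by
    subst hs
    simpa using lower_le_deg _ _ (hmem s).1
  -- The bound in `lower` is strict, so `lower R r i j` is the step `i - 1`, which is zero for `i =
  -- 0`.
  fil i j := lower R r (i + 1) j
  fil_le_deg i j := lower_le_deg _ _
  fil_mono i j := lower_mono (Nat.le_succ _) j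
  fil_exhaustive j x hx := by
    refine ⟨x.support.sup Sigma.fst, (Finsupp.mem_supported _ _).2 fun s hs => ⟨?_, ?_⟩⟩
    · exact Nat.lt_succ_of_le (Finset.le_sup (f := Sigma.fst) hs)
    · exact (Finsupp.mem_supported _ _).1 hx hs
  diff_fil_zero j := map_supported_le _ ⊥ _ fun s hs => by
    have h := lower_mono (Nat.lt_succ_iff.1 hs.1) _ (hmem s).1
    rw [lower_zero] at h
    simpa using h
  diff_fil_succ i j := map_supported_le _ _ _ fun s hs => by
    obtain ⟨h, rfl⟩ := hs
    simpa using lower_mono (Nat.lt_succ_iff.1 h) _ (hmem s).1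

/-- The augmentation of the flag defined by `v`. -/
noncomputable def aug (v : Idx r → (Idx r →₀ R) × D.carrier)
    (hmem : ∀ s, v s ∈ cone r D s.1 (s.degree - 1)) (hcyc : ∀ s, coneDiff v (v s) = 0) :
    DiffMod.Hom (flag v hmem hcyc).toDiffMod D where
  toLin := LinearMap.snd R _ _ ∘ₗ Finsupp.linearCombination R v
  comm x := (congrArg Prod.snd (linearCombination_comm hcyc x)).symm
  mem_deg j := linearCombination_snd_mem hmem j

section Flag

variable {v : Idx r → (Idx r →₀ R) × D.carrier}
  {hmem : ∀ s, v s ∈ cone r D s.1 (s.degree - 1)} {hcyc : ∀ s, coneDiff v (v s) = 0}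

theorem flag_filBelow (i : ℕ) (j : ZMod d) :
    (flag v hmem hcyc).filBelow i j = lower R r i j := by
  cases i with
  | zero => exact (lower_zero j).symm
  | succ i => rfl

theorem free_gr (i : ℕ) (j : ZMod d) : Module.Free R ((flag v hmem hcyc).gr i j) := by
  obtain ⟨f, hf, hker⟩ := exists_lower_surjective R r i j
  let f' : (flag v hmem hcyc).fil i j →ₗ[R] ({s : Idx r | s.1 = i ∧ s.degree = j} →₀ R) := f
  have hker' : LinearMap.ker f' =
      ((flag v hmem hcyc).filBelow i j).submoduleOf ((flag v hmem hcyc).fil i j) := by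
    rw [flag_filBelow]
    exact Submodule.ext hker
  exact Module.Free.of_equiv
    ((Submodule.quotEquivOfEq _ _ hker'.symm).trans (f'.quotKerEquivOfSurjective hf)).symm

theorem coneAcyclic (hex : ∀ n j, ∀ c ∈ cone r D n j, coneDiff v c = 0 →
      ∃ b ∈ cone r D (n + 1) (j + 1), coneDiff v b = c) :
    (flag v hmem hcyc).ConeAcyclic (aug v hmem hcyc) := by
  intro i j z hz ζ hζ hdz hζz
  rw [flag_filBelow] at hz
  have hdz' : (Finsupp.linearCombination R v z).1 = 0 := hdz
  have hζz' : D.diff ζ = (Finsupp.linearCombination R v z).2 := hζz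
  have hc : coneDiff v (z, ζ) = 0 :=
    Prod.ext ((sub_zero _).trans hdz') (sub_eq_zero.2 hζz'.symm)
  obtain ⟨⟨y, k⟩, ⟨hy, hk⟩, hb⟩ := hex i j (z, ζ) ⟨hz, hζ⟩ hc
  refine ⟨y, hy, k, hk, ?_, ?_⟩
  · exact (sub_zero _).symm.trans (congrArg Prod.fst hb)
  · have h2 : (Finsupp.linearCombination R v y).2 - D.diff k = ζ := congrArg Prod.snd hb
    change D.diff k = (Finsupp.linearCombination R v y).2 - ζ
    rw [← h2, sub_sub_cancel]

/-- For each `x` the pair `(∂x, a x)` is a cycle of the cone, so `hmin` applies to it. -/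
theorem isMinimal [IsLocalRing R] (hmin : ∀ n j, ∀ e ∈ cone r D (n + 1) j, coneDiff v e = 0 →
      e.1 ∈ IsLocalRing.maximalIdeal R • lower R r (n + 1) j ⊔ lower R r n j) :
    (flag v hmem hcyc).IsMinimal := by
  intro n j x hx
  rw [flag_filBelow]
  refine hmin n (j - 1) (Finsupp.linearCombination R v x)
    ⟨(flag v hmem hcyc).diff_fil_succ n j x hx, ?_⟩ (coneDiff_linearCombination hcyc x)
  rw [sub_add_cancel]
  exact linearCombination_snd_mem hmem j x ((flag v hmem hcyc).fil_le_deg _ _ hx)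

end Flag

end Stage

/-! ### Existence and the main theorem -/

theorem FlagResolution.exists_isQuasiminimal {R : Type u} [CommRing R] [IsNoetherianRing R]
    [IsLocalRing R] {d : ℕ} (D : DiffMod.{u, v} R d) (hD : ∀ j, Module.Finite R (D.homology j)) :
    ∃ Q : FlagResolution.{u, v, u} D, Q.IsQuasiminimal := by
  choose r K ε δ hε hεK hrange hker hK using fun t =>
    have := hD t
    IsLocalRing.exists_minimal_syzygies (R := R) (D.homology t)
  obtain ⟨v, hmem, hcyc, hex, hmin⟩ := Stage.exists_coneDiff (D := D) (r := fun n t => r t n)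
    (K := fun n t => K t n) (IsLocalRing.maximalIdeal R) (fun n t => hK t n) ε hε hεK
    (fun n t => δ t n) (fun n t => hrange t n) (fun n t => hker t n)
  have hfree : ∀ i j, Module.Free R ((Stage.flag v hmem hcyc).gr i j) := Stage.free_gr
  have hproj : (Stage.flag v hmem hcyc).IsProjective := fun i j =>
    have := hfree i j
    Module.Projective.of_free
  have hcone := Stage.coneAcyclic (hmem := hmem) (hcyc := hcyc) hex
  exact ⟨⟨Stage.flag v hmem hcyc, hproj, Stage.aug v hmem hcyc, hcone.isQuasiIso⟩, fun t =>
    ⟨DiffFlag.anchorAug (Stage.aug v hmem hcyc) t,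
      { toIsProjectiveResolution := hcone.isProjectiveResolution hproj t
        free := fun n => hfree n _
        minimal := DiffFlag.isMinimal_iff.1 (Stage.isMinimal (hmem := hmem) (hcyc := hcyc) hmin) t }⟩⟩

theorem theorem1p2 {R : Type u} [CommRing R] [IsNoetherianRing R] [IsLocalRing R] (d : ℕ)
    (D : DiffMod.{u, v} R d) (hD : ∀ j, Module.Finite R (D.homology j)) :
    -- existence of a quasiminimal anchored resolution
    (∃ Q : FlagResolution.{u, v, u} D, Q.IsQuasiminimal) ∧
    -- any two quasiminimal resolutions are isomorphic by a flag-preserving isomorphism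
    (∀ (Q : FlagResolution.{u, v, w} D) (Q' : FlagResolution.{u, v, w'} D),
      Q.IsQuasiminimal → Q'.IsQuasiminimal →
      ∃ (f : DiffFlag.Hom Q.flag Q'.flag) (g : DiffFlag.Hom Q'.flag Q.flag),
        g.comp f = DiffFlag.Hom.id Q.flag ∧ f.comp g = DiffFlag.Hom.id Q'.flag ∧
        FlagResolution.RespectsAug f ∧ FlagResolution.RespectsAug g) ∧
    -- any two anchored resolutions are homotopy equivalent in a flag-preserving way
    (∀ (F : FlagResolution.{u, v, w} D) (F' : FlagResolution.{u, v, w'} D),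
      F.IsAnchored → F'.IsAnchored →
      ∃ (f : DiffFlag.Hom F.flag F'.flag) (g : DiffFlag.Hom F'.flag F.flag),
        (g.comp f).Homotopic (DiffFlag.Hom.id F.flag) ∧
        (f.comp g).Homotopic (DiffFlag.Hom.id F'.flag) ∧
        FlagResolution.RespectsAug f ∧ FlagResolution.RespectsAug g) ∧
    -- every anchored resolution contains every quasiminimal one as a flag-preserving summand
    (∀ (F : FlagResolution.{u, v, w} D) (Q : FlagResolution.{u, v, w'} D),
      F.IsAnchored → Q.IsQuasiminimal →
      ∃ (i : DiffFlag.Hom Q.flag F.flag) (p : DiffFlag.Hom F.flag Q.flag),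
        p.comp i = DiffFlag.Hom.id Q.flag ∧
        FlagResolution.RespectsAug i ∧ FlagResolution.RespectsAug p) := by
  refine ⟨FlagResolution.exists_isQuasiminimal D hD, ?_, ?_, ?_⟩
  · intro Q Q' hQ hQ'
    obtain ⟨f, hf⟩ := FlagResolution.IsAnchored.exists_respectsAug Q hQ'.isAnchored
    obtain ⟨g, hg⟩ := FlagResolution.IsAnchored.exists_respectsAug Q' hQ.isAnchored
    obtain ⟨p, hpf, hp⟩ := hQ.exists_retraction hD hf hg
    -- The retraction `p` of `f` also respects the augmentations, so it has a retraction `q` of its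
    -- own. With left inverse `q` and right inverse `f`, it is an isomorphism and `q = f`.
    obtain ⟨q, hqp, -⟩ := hQ'.exists_retraction hD hp hf
    refine ⟨f, p, hpf, ?_, hf, hp⟩
    have hqf : q = f := by
      calc q = q.comp (p.comp f) := by rw [hpf]; rfl
        _ = (q.comp p).comp f := rfl
        _ = f := by rw [hqp]; rfl
    rw [← hqf, hqp]
  · intro F F' hF hF'
    obtain ⟨f, hf⟩ := FlagResolution.IsAnchored.exists_respectsAug F hF'
    obtain ⟨g, hg⟩ := FlagResolution.IsAnchored.exists_respectsAug F' hF
    exact ⟨f, g, hF.homotopic_id (hg.comp hf), hF'.homotopic_id (hf.comp hg), hf, hg⟩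
  · intro F Q hF hQ
    obtain ⟨i, hi⟩ := FlagResolution.IsAnchored.exists_respectsAug Q hF
    obtain ⟨g, hg⟩ := FlagResolution.IsAnchored.exists_respectsAug F hQ.isAnchored
    obtain ⟨p, hpi, hp⟩ := hQ.exists_retraction hD hi hg
    exact ⟨i, p, hpi, hi, hp⟩
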